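/- Let $G$ be a (finite-dimensional) complex Lie group with Lie algebra $\mathfrak g$. Let $\sigma^0$ be an involution of $G$ (a holomorphic automorphism with $\sigma^0\circ\sigma^0=\mathrm{id}$) and $\rho^0$ a reality condition on $G$ (an antiholomorphic automorphism with $\rho^0\circ\rho^0=\mathrm{id}$), and suppose that $\sigma^0$ and $\rho^0$ commute. Let $\Lambda G$ be the group of real analytic maps $\gamma:S^1\to G$, put $(\sigma\gamma)(\lambda)=\sigma^0(\gamma(-\lambda))$ and $(\rho\gamma)(\lambda)=\rho^0(\gamma(\bar\lambda))$, let $\mathcal H=\Lambda G_\sigma$ be the subgroup of loops fixed by $\sigma$, and $\mathcal H_\rho$ the subgroup of loops fixed by both $\sigma$ and $\rho$. For a real manifold $X$ with base point $p$ and a subgroup $\mathcal K\subset\Lambda G$, let $\mathcal K(X)_1^1$ be the set of smooth maps $F:X\to\mathcal K$, $x\mapsto (\lambda\mapsto F_\lambda(x))$, with $F(p)=1$, whose Maurer–Cartan form has the shape $F_\lambda^{-1}\,\mathrm dF_\lambda=\lambda\,\eta$ for all $\lambda\in S^1$, with $\eta$ a $\mathfrak g$-valued $1$-form on $X$ that does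 not depend on $\lambda$. Here a map $F$ into $\Lambda G$ is smooth, respectively real analytic, if $(x,\lambda)\mapsto F_\lambda(x)$ is so on $X\times S^1$; if $X$ is a complex manifold, $F$ is holomorphic if it is real analytic and $x\mapsto F_\lambda(x)$ is holomorphic for every $\lambda$. Let $M$ be a connected paracompact Hausdorff real analytic manifold of dimension $m$ with base point $p$, embedded real analytically as a totally real submanifold of a Hausdorff complex manifold $M_{\mathbf C}$ of complex dimension $m$. Let $F_+\in\mathcal H_\rho(M)_1^1$ be real analytic (a real analytic extended curved flat). Then there exists an open submanifold $M_\epsilon$ of $M_{\mathbf C}$ containing $M$ such that there is exactly one holomorphic element $\hat F_+\in\mathcal H(M_\epsilon)_1^1$ (with the same base point $p\in M\subset M_\epsilon$) whose restriction to $M$ is $F_+$. -/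

import Mathlib

open scoped Manifold ContDiff

noncomputable section

namespace CurvedFlat

/-! ### A complex manifold is a real analytic manifold

A manifold modelled on a complex vector space `E` is regarded as a real manifold by using the same
charts, with the model `𝓘(ℝ, E)` in place of `𝓘(ℂ, E)`. -/

section RestrictScalars

variable {E : Type*} [NormedAddCommGroup E] [NormedSpace ℂ E]

theorem contMDiff_real {F : Type*} [NormedAddCommGroup F] [NormedSpace ℂ F]
    {X : Type*} [TopologicalSpace X] [ChartedSpace E X]
    {Y : Type*} [TopologicalSpace Y] [ChartedSpace F Y] {n : ℕ∞ω} {f : X → Y}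
    (hf : ContMDiff 𝓘(ℂ, E) 𝓘(ℂ, F) n f) : ContMDiff 𝓘(ℝ, E) 𝓘(ℝ, F) n f := by
  intro x
  have h := hf x
  rw [contMDiffAt_iff] at *
  exact ⟨h.1, h.2.restrict_scalars ℝ⟩

theorem contMDiff_prod_real {X : Type*} [TopologicalSpace X] [ChartedSpace E X] {n : ℕ∞ω}
    {f : X × X → X} (hf : ContMDiff (𝓘(ℂ, E).prod 𝓘(ℂ, E)) 𝓘(ℂ, E) n f) :
    ContMDiff (𝓘(ℝ, E).prod 𝓘(ℝ, E)) 𝓘(ℝ, E) n f := by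
  intro x
  have h := hf x
  rw [contMDiffAt_iff] at *
  exact ⟨h.1, h.2.restrict_scalars ℝ⟩

theorem isManifold_real {X : Type*} [TopologicalSpace X] [ChartedSpace E X] {n : ℕ∞ω}
    [IsManifold 𝓘(ℂ, E) n X] : IsManifold 𝓘(ℝ, E) n X := by
  apply isManifold_of_contDiffOn
  intro e e' he he'
  have h := (contDiffGroupoid n 𝓘(ℂ, E)).compatible he he'
  rw [contDiffGroupoid, mem_groupoid_of_pregroupoid] at h
  exact ContDiffOn.restrict_scalars ℝ h.1

theorem lieGroup_real {G : Type*} [TopologicalSpace G] [ChartedSpace E G] [Group G]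
    [LieGroup 𝓘(ℂ, E) ω G] : LieGroup 𝓘(ℝ, E) ω G :=
  { (isManifold_real : IsManifold 𝓘(ℝ, E) ω G) with
    contMDiff_mul := contMDiff_prod_real (contMDiff_mul 𝓘(ℂ, E) ω)
    contMDiff_inv := contMDiff_real (contMDiff_inv 𝓘(ℂ, E) ω) }

end RestrictScalars

/-! ### The differential of a map between manifolds -/

/-- The differential at `x` of a map between real manifolds modelled on `V` and `E`. The tangent
spaces are the model spaces, so this is a real linear map `V → E`. -/
def differential (V : Type*) [NormedAddCommGroup V] [NormedSpace ℝ V]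
    (E : Type*) [NormedAddCommGroup E] [NormedSpace ℝ E]
    {X : Type*} [TopologicalSpace X] [ChartedSpace V X]
    {Y : Type*} [TopologicalSpace Y] [ChartedSpace E Y] (f : X → Y) (x : X) : V →L[ℝ] E :=
  mfderiv 𝓘(ℝ, V) 𝓘(ℝ, E) f x

/-! ### Involutions of a complex Lie group -/

section Involutions

variable (E : Type*) [NormedAddCommGroup E] [NormedSpace ℂ E]
  {G : Type*} [TopologicalSpace G] [ChartedSpace E G] [Group G]

/-- `σ` is an involution of the complex Lie group `G`: a holomorphic automorphism with
`σ ∘ σ = id`. -/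
def IsInvolution (σ : G →* G) : Prop :=
  ContMDiff 𝓘(ℂ, E) 𝓘(ℂ, E) ω σ ∧ ∀ g, σ (σ g) = g

/-- `ρ` is a reality condition on the complex Lie group `G`: an antiholomorphic automorphism
(real analytic, with conjugate-linear differential) with `ρ ∘ ρ = id`. -/
def IsRealityCondition (ρ : G →* G) : Prop :=
  ContMDiff 𝓘(ℝ, E) 𝓘(ℝ, E) ω ρ ∧
  (∀ (g : G) (v : E),
    differential E E ρ g (Complex.I • v) = -(Complex.I • differential E E ρ g v)) ∧
  ∀ g, ρ (ρ g) = g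

end Involutions

/-! ### Loop groups -/

section LoopGroups

variable (E : Type*) [NormedAddCommGroup E] [NormedSpace ℂ E]
  {G : Type*} [TopologicalSpace G] [ChartedSpace E G] [Group G]

/-- The loop group `ΛG` of real analytic maps from the unit circle into the complex Lie group `G`,
with pointwise operations. -/
def loopGroup (G : Type*) [TopologicalSpace G] [ChartedSpace E G] [Group G]
    [LieGroup 𝓘(ℂ, E) ω G] : Subgroup (Circle → G) where
  carrier := {γ | ContMDiff (𝓡 1) 𝓘(ℝ, E) ω γ}
  mul_mem' := fun ha hb => by
    have : LieGroup 𝓘(ℝ, E) ω G := lieGroup_real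
    exact ContMDiff.mul ha hb
  one_mem' := contMDiff_const
  inv_mem' := fun ha => by
    have : LieGroup 𝓘(ℝ, E) ω G := lieGroup_real
    exact ContMDiff.inv ha

/-- The extension of `σ⁰ : G → G` to loops, `(σ γ)(z) = σ⁰ (γ (-z))`. -/
def twist (σ₀ : G →* G) : (Circle → G) →* (Circle → G) where
  toFun γ z := σ₀ (γ (-z))
  map_one' := by ext z; simp
  map_mul' a b := by ext z; simp

/-- The extension of `ρ⁰ : G → G` to loops, `(ρ γ)(z) = ρ⁰ (γ (conj z))`; on the unit circle the
complex conjugate of `z` is `z⁻¹`. -/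
def conjTwist (ρ₀ : G →* G) : (Circle → G) →* (Circle → G) where
  toFun γ z := ρ₀ (γ z⁻¹)
  map_one' := by ext z; simp
  map_mul' a b := by ext z; simp

variable [LieGroup 𝓘(ℂ, E) ω G]

/-- The twisted loop group `𝓗 = ΛG_σ`: the loops fixed by `σ`. -/
def twistedLoopGroup (σ₀ : G →* G) : Subgroup (Circle → G) :=
  loopGroup E G ⊓ (twist σ₀).eqLocus (MonoidHom.id _)

/-- The real twisted loop group `𝓗_ρ = ΛG_{ρσ}`: the loops fixed by both `σ` and `ρ`. -/
def realTwistedLoopGroup (σ₀ ρ₀ : G →* G) : Subgroup (Circle → G) :=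
  twistedLoopGroup E σ₀ ⊓ (conjTwist ρ₀).eqLocus (MonoidHom.id _)

end LoopGroups

/-! ### Maps into loop groups and their connection order -/

section LoopMaps

variable {V : Type*} [NormedAddCommGroup V] [NormedSpace ℝ V]
  {X : Type*} [TopologicalSpace X] [ChartedSpace V X]
  {E : Type*} [NormedAddCommGroup E] [NormedSpace ℂ E]
  {G : Type*} [TopologicalSpace G] [ChartedSpace E G] [Group G]

variable (V E) in
/-- The value at `x` of the Maurer-Cartan form `f⁻¹ df` of a map `f : X → G`, a real linear map
from the tangent space of `X` at `x` to the Lie algebra of `G`. It is the differential of `f`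
at `x` followed by the differential of left translation by `(f x)⁻¹`, that is, the differential
at `x` of the map `y ↦ (f x)⁻¹ * f y`, which sends `x` to `1`. (All tangent spaces of `X`,
respectively `G`, are copies of the model space `V`, respectively `E`.) -/
def maurerCartan (f : X → G) (x : X) : V →L[ℝ] E :=
  differential V E (fun y => (f x)⁻¹ * f y) x

variable (V E) in
/-- The family `F` of loops in `G` is a map of class `C^n` from the real manifold `X` into the
loop group: `F x z` is of class `C^n` jointly in the point `x` and the loop parameter `z`. -/
def IsLoopMapOfClass (n : ℕ∞ω) (F : X → Circle → G) : Prop :=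
  ContMDiff (𝓘(ℝ, V).prod (𝓡 1)) 𝓘(ℝ, E) n (fun q : X × Circle => F q.1 q.2)

variable (V E) in
/-- The set `𝓗(X)_a^b` of connection order `(a, b)` maps from the real manifold `X`, with base
point `p`, into a group `𝓗` of loops in `G`: the smooth maps `F : X → 𝓗` with `F p = 1` such that
the Fourier expansion `∑ zⁱ Aᵢ` in the loop parameter `z` of the Maurer-Cartan form of `F` has
only terms with `a ≤ i ≤ b`. -/
def connectionOrderMaps (H : Subgroup (Circle → G)) (p : X) (a b : ℤ) :
    Set (X → Circle → G) :=
  {F | (∀ x, F x ∈ H) ∧ IsLoopMapOfClass V E ∞ F ∧ F p = 1 ∧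
    ∀ x, ∃ A : ℤ → (V →L[ℝ] E), ∀ z : Circle,
      maurerCartan V E (fun y => F y z) x = ∑ i ∈ Finset.Icc a b, ((z : ℂ) ^ i) • A i}

variable (V E) in
/-- `F` is a real analytic map from the real analytic manifold `X` into the loop group. -/
def IsAnalyticLoopMap (F : X → Circle → G) : Prop :=
  IsLoopMapOfClass V E ω F

end LoopMaps

section Holomorphic

variable (W : Type*) [NormedAddCommGroup W] [NormedSpace ℂ W]
  {X : Type*} [TopologicalSpace X] [ChartedSpace W X]
  (E : Type*) [NormedAddCommGroup E] [NormedSpace ℂ E]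
  {G : Type*} [TopologicalSpace G] [ChartedSpace E G] [Group G]

/-- `F` is a holomorphic map from the complex manifold `X` into the loop group: it is real
analytic, and satisfies the Cauchy-Riemann equations in `X`, that is, `x ↦ F x z` is complex
differentiable for each value `z` of the loop parameter. -/
def IsHolomorphicLoopMap (F : X → Circle → G) : Prop :=
  IsAnalyticLoopMap W E F ∧ ∀ z : Circle, MDifferentiable 𝓘(ℂ, W) 𝓘(ℂ, E) (fun x => F x z)

end Holomorphic

/-! ### Totally real embeddings -/

/-- `ι` is a totally real, real analytic embedding of the real analytic manifold `M` into the
complex manifold `N`: a topological embedding which is real analytic, has injective differential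
`dι` at each point, and satisfies `dι(T_x M) ∩ i dι(T_x M) = 0`. -/
structure IsTotallyRealEmbedding
    (V : Type*) [NormedAddCommGroup V] [NormedSpace ℝ V]
    (W : Type*) [NormedAddCommGroup W] [NormedSpace ℂ W]
    {M : Type*} [TopologicalSpace M] [ChartedSpace V M]
    {N : Type*} [TopologicalSpace N] [ChartedSpace W N] (ι : M → N) : Prop where
  isEmbedding : Topology.IsEmbedding ι
  analytic : ContMDiff 𝓘(ℝ, V) 𝓘(ℝ, W) ω ι
  injective : ∀ x : M, Function.Injective (differential V W ι x)
  totallyReal : ∀ (x : M) (v w : V),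
    differential V W ι x v = Complex.I • differential V W ι x w → v = 0

end CurvedFlat

end

/-!
The extension is constructed directly from power series, without integrating the Maurer-Cartan
form.

*Local extension.* Read in charts, a totally real analytic embedding of half dimension is an
analytic germ `V → W` whose differential `J` satisfies `W = J V ⊕ i J V`. A real analytic germ on
`V` extends to a holomorphic germ on `W`: replace each term of its Taylor series by the complex
multilinear map with the same values on a real basis (`exists_complexification`). Applied to the
embedding itself, this gives a holomorphic germ whose differential is the identity, and the inverse
function theorem turns it into a chart of `N` in which `M` is the linear subspace `J V`
(`AdaptedChart`, `nonempty_adaptedChart`). Applied to the family `F`, as a function of the point and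
of the loop parameter jointly, it gives an extension that is holomorphic in the point and jointly
real analytic, near each point of `M` and each loop parameter.

*Uniqueness.* A holomorphic function vanishing on `J V` vanishes nearby, by the identity theorem
on the complex lines `t ↦ J a + t J b` (`eventually_eq_zero_of_totallyReal`). As `G` is
Hausdorff, holomorphic maps from a connected open set meeting `M` into `G` are determined by their
values on `M` (`AdaptedChart.eqOn_of_comp`). This makes the local extensions agree for overlapping
arcs of the circle, so that compactness of the circle gives one extension for all loop parameters
near each point of `M` (`AdaptedChart.exists_localExtension`). It also yields the uniqueness claim,
since `Me` is a union of coordinate balls centred at points of `M`, and the twisting condition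
`σ₀ (F (-z)) = F z`, which is an equality of holomorphic maps.

*Gluing.* Two coordinate balls centred on `M` may overlap in a set that does not meet `M`. Since `M`
is connected and paracompact it is `σ`-compact, so its image has a second countable, hence
metrizable, neighbourhood. There the balls can be taken so small that of two overlapping ones, one is
contained in the domain of an extension around the centre of the other (`exists_shrinking`), and
uniqueness on that ball applies (`exists_global_extension`).

*Maurer-Cartan form.* For fixed `z`, the form of the extension is a holomorphic function with values
in the complex linear maps `W → E`. The equation `α_z = z α_1` holds on the tangent vectors of
`M`, which span over `ℂ`, and so holds on a whole coordinate ball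
(`AdaptedChart.exists_maurerCartan_eq_smul`).
-/

noncomputable section

namespace CurvedFlat

open Filter Topology

/-! ### Totally real subspaces and complexification of analytic germs -/

section Complexification

variable {V : Type*} [NormedAddCommGroup V] [NormedSpace ℝ V]
  {W : Type*} [NormedAddCommGroup W] [NormedSpace ℂ W]
  {E : Type*} [NormedAddCommGroup E] [NormedSpace ℂ E]

/-- The real linear map `J : V → W` has complex coordinates: there are vectors `e k` of `V` and
complex linear forms `ℓ k` on `W` that restrict to real coordinates on `V` for the `e k`. -/
def HasComplexCoordinates (J : V →L[ℝ] W) : Prop :=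
  ∃ (m : ℕ) (e : Fin m → V) (ℓ : Fin m → W →L[ℂ] ℂ),
    ∀ v, ∃ r : Fin m → ℝ, v = ∑ k, r k • e k ∧ ∀ k, ℓ k (J v) = (r k : ℂ)

/-- The complex multilinear extension of the real multilinear map `p`, with respect to vectors
`e k` and complex linear coordinates `ℓ k`. -/
def complexifyMultilinear {m n : ℕ} (e : Fin m → V) (ℓ : Fin m → W →L[ℂ] ℂ)
    (p : V [×n]→L[ℝ] E) : W [×n]→L[ℂ] E :=
  ∑ K : Fin n → Fin m, ((ContinuousMultilinearMap.mkPiAlgebra ℂ (Fin n) ℂ).compContinuousLinearMap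
    (fun i => ℓ (K i))).smulRight (p (fun i => e (K i)))

theorem complexifyMultilinear_apply {m n : ℕ} (e : Fin m → V) (ℓ : Fin m → W →L[ℂ] ℂ)
    (p : V [×n]→L[ℝ] E) (w : Fin n → W) :
    complexifyMultilinear e ℓ p w
      = ∑ K : Fin n → Fin m, (∏ i, ℓ (K i) (w i)) • p (fun i => e (K i)) := by
  simp [complexifyMultilinear]

theorem norm_complexifyMultilinear_le {m n : ℕ} (e : Fin m → V) (ℓ : Fin m → W →L[ℂ] ℂ)
    (p : V [×n]→L[ℝ] E) :
    ‖complexifyMultilinear e ℓ p‖ ≤ ‖p‖ * (∑ k, ‖ℓ k‖ * ‖e k‖) ^ n := by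
  refine ContinuousMultilinearMap.opNorm_le_bound (by positivity) fun w => ?_
  rw [complexifyMultilinear_apply]
  calc ‖∑ K : Fin n → Fin m, (∏ i, ℓ (K i) (w i)) • p (fun i => e (K i))‖
      ≤ ∑ K : Fin n → Fin m, ‖(∏ i, ℓ (K i) (w i)) • p (fun i => e (K i))‖ := norm_sum_le _ _
    _ ≤ ∑ K : Fin n → Fin m, ‖p‖ * (∏ i, (‖ℓ (K i)‖ * ‖e (K i)‖)) * ∏ i, ‖w i‖ := by
        refine Finset.sum_le_sum fun K _ => ?_
        rw [norm_smul, norm_prod]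
        calc (∏ i, ‖ℓ (K i) (w i)‖) * ‖p (fun i => e (K i))‖
            ≤ (∏ i, ‖ℓ (K i)‖ * ‖w i‖) * (‖p‖ * ∏ i, ‖e (K i)‖) := by
              gcongr
              · exact (ℓ (K _)).le_opNorm _
              · exact p.le_opNorm _
          _ = _ := by simp only [Finset.prod_mul_distrib]; ring
    _ = _ := by
        rw [← Finset.sum_mul, ← Finset.mul_sum, Fintype.sum_pow]

theorem complexifyMultilinear_apply_real {m n : ℕ} (e : Fin m → V) (ℓ : Fin m → W →L[ℂ] ℂ)
    (p : V [×n]→L[ℝ] E) {r : Fin m → ℝ} {w : W} (h : ∀ k, ℓ k w = (r k : ℂ)) :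
    complexifyMultilinear e ℓ p (fun _ => w) = p (fun _ => ∑ k, r k • e k) := by
  rw [complexifyMultilinear_apply, ContinuousMultilinearMap.map_sum]
  refine Finset.sum_congr rfl fun K _ => ?_
  rw [ContinuousMultilinearMap.map_smul_univ]
  simp only [h]
  rw [← Complex.ofReal_prod]
  rfl

/-- A real analytic germ on `V` extends to a holomorphic germ on `W`. -/
theorem exists_complexification [CompleteSpace E] {J : V →L[ℝ] W} (hJ : HasComplexCoordinates J)
    {f : V → E} {c : V} (hf : AnalyticAt ℝ f c) :
    ∃ g : W → E, AnalyticAt ℂ g (J c) ∧ ∀ᶠ v in 𝓝 c, g (J v) = f v := by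
  obtain ⟨m, e, ℓ, hcoord⟩ := hJ
  obtain ⟨p, r, hp⟩ := hf
  let q : FormalMultilinearSeries ℂ W E := fun n => complexifyMultilinear e ℓ (p n)
  have hq : 0 < q.radius := by
    obtain ⟨s, hs0, hs⟩ := ENNReal.lt_iff_exists_nnreal_btwn.1 (hp.r_pos.trans_le hp.r_le)
    obtain ⟨C, hC, hb⟩ := p.norm_mul_pow_le_of_lt_radius hs
    set B : ℝ := ∑ k, ‖ℓ k‖ * ‖e k‖
    have hB : 0 ≤ B := by positivity
    have hs0' : (0 : ℝ) < s := by exact_mod_cast hs0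
    let t : NNReal := ⟨s / (B + 1), by positivity⟩
    have ht : 0 < t := by
      change (0 : ℝ) < s / (B + 1)
      positivity
    refine lt_of_lt_of_le (ENNReal.coe_pos.2 ht) (q.le_radius_of_bound C fun n => ?_)
    have htB : B * (t : ℝ) ≤ s := by
      change B * (s / (B + 1)) ≤ s
      rw [mul_div_assoc', div_le_iff₀ (by positivity)]
      nlinarith
    calc ‖q n‖ * (t : ℝ) ^ n ≤ ‖p n‖ * B ^ n * (t : ℝ) ^ n := by
          gcongr
          exact norm_complexifyMultilinear_le e ℓ (p n)
      _ = ‖p n‖ * (B * (t : ℝ)) ^ n := by rw [mul_pow]; ring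
      _ ≤ ‖p n‖ * (s : ℝ) ^ n := by gcongr
      _ ≤ C := hb n
  have hqs := q.hasFPowerSeriesOnBall hq
  refine ⟨fun w => q.sum (w - J c), ?_, ?_⟩
  · have h0 : AnalyticAt ℂ q.sum (J c - J c) := by
      rw [sub_self]; exact hqs.analyticAt
    exact h0.comp (f := fun w => w - J c) (analyticAt_id.sub analyticAt_const)
  · have h1 : ∀ᶠ v in 𝓝 c, v ∈ Metric.eball c r := Metric.eball_mem_nhds c hp.r_pos
    have h2 : ∀ᶠ v in 𝓝 c, J v - J c ∈ Metric.eball (0 : W) q.radius := by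
      have : ContinuousAt (fun v => J v - J c) c := by fun_prop
      apply this
      simpa using Metric.eball_mem_nhds (0 : W) hq
    filter_upwards [h1, h2] with v hv1 hv2
    have hv1' : v - c ∈ Metric.eball (0 : V) r := by
      simpa [Metric.mem_eball, edist_eq_enorm_sub] using hv1
    have hs1 := hp.hasSum hv1'
    have hs2 := hqs.hasSum hv2
    rw [zero_add] at hs2
    rw [add_sub_cancel] at hs1
    refine hs2.unique ?_
    convert! hs1 using 1
    ext n
    obtain ⟨a, ha, hl⟩ := hcoord (v - c)
    have := complexifyMultilinear_apply_real e ℓ (p n) (w := J v - J c) (r := a)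
      (fun k => by rw [← map_sub]; exact hl k)
    rw [← ha] at this
    exact this

section TotallyReal

variable [FiniteDimensional ℝ V] [FiniteDimensional ℂ W] {J : V →L[ℝ] W}

/-- If the totally real map `J` has half the real dimension of its target, every vector of the
target splits as `J a + i J b`. -/
theorem exists_real_add_imaginary (hdim : Module.finrank ℂ W = Module.finrank ℝ V)
    (hJ : ∀ v w, J v = Complex.I • J w → v = 0) :
    ∃ e : W ≃L[ℝ] V × V, ∀ a b, e (J a + Complex.I • J b) = (a, b) := by
  have : FiniteDimensional ℝ W := FiniteDimensional.complexToReal W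
  let T : V × V →ₗ[ℝ] W :=
    { toFun := fun q => J q.1 + Complex.I • J q.2
      map_add' := fun q q' => by simp only [Prod.fst_add, Prod.snd_add, map_add, smul_add]; abel
      map_smul' := fun r q => by
        simp only [Prod.smul_fst, Prod.smul_snd, map_smul, smul_add, RingHom.id_apply]
        rw [smul_comm] }
  have hT : Function.Injective T := by
    rw [← LinearMap.ker_eq_bot, LinearMap.ker_eq_bot']
    rintro ⟨a, b⟩ h
    have h' : J a + Complex.I • J b = 0 := h
    have ha : a = 0 := hJ a (-b) (by rw [map_neg, smul_neg]; exact eq_neg_of_add_eq_zero_left h')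
    subst ha
    have hb : J b = 0 := by simpa using h'
    have : b = 0 := hJ b 0 (by simp [hb])
    simp [this]
  have hfr : Module.finrank ℝ (V × V) = Module.finrank ℝ W := by
    rw [finrank_real_of_complex, hdim, Module.finrank_prod, two_mul]
  let e := (LinearEquiv.ofInjectiveOfFinrankEq T hT hfr).toContinuousLinearEquiv
  refine ⟨e.symm, fun a b => ?_⟩
  rw [ContinuousLinearEquiv.symm_apply_eq]
  rfl

theorem hasComplexCoordinates_of_totallyReal
    (hdim : Module.finrank ℂ W = Module.finrank ℝ V)
    (hJ : ∀ v w, J v = Complex.I • J w → v = 0) : HasComplexCoordinates J := by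
  obtain ⟨T, hT⟩ := exists_real_add_imaginary hdim hJ
  let b := Module.finBasis ℝ V
  have hli : LinearIndependent ℂ (fun k => J (b k)) := by
    rw [Fintype.linearIndependent_iff]
    intro g hg
    have h : J (∑ k, (g k).re • b k) + Complex.I • J (∑ k, (g k).im • b k) = 0 := by
      rw [← hg, map_sum, map_sum, Finset.smul_sum, ← Finset.sum_add_distrib]
      refine Finset.sum_congr rfl fun k _ => ?_
      conv_rhs => rw [← Complex.re_add_im (g k), add_smul, mul_comm, mul_smul]
      simp
    have h2 := congrArg T h
    rw [hT, map_zero, Prod.mk_eq_zero] at h2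
    have hre := (Fintype.linearIndependent_iff.1 b.linearIndependent) _ h2.1
    have him := (Fintype.linearIndependent_iff.1 b.linearIndependent) _ h2.2
    intro k
    exact Complex.ext (hre k) (him k)
  let B := basisOfLinearIndependentOfCardEqFinrank' _ hli (by simp [hdim])
  refine ⟨_, b, fun k => LinearMap.toContinuousLinearMap (B.coord k), fun v =>
    ⟨fun k => b.repr v k, (b.sum_repr v).symm, fun k => ?_⟩⟩
  have hB : ∀ i, J (b i) = B i := fun i =>
    (congrFun (coe_basisOfLinearIndependentOfCardEqFinrank' _ hli (by simp [hdim])) i).symm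
  have : J v = ∑ i, ((b.repr v i : ℝ) : ℂ) • B i := by
    conv_lhs => rw [← b.sum_repr v, map_sum]
    refine Finset.sum_congr rfl fun i _ => ?_
    rw [map_smul, hB]
    rfl
  rw [this]
  simp [Finsupp.single_apply]

theorem clm_eq_zero_of_comp_totallyReal {Y : Type*} [NormedAddCommGroup Y] [NormedSpace ℂ Y]
    (hdim : Module.finrank ℂ W = Module.finrank ℝ V)
    (hJ : ∀ v w, J v = Complex.I • J w → v = 0) {A : W →L[ℂ] Y} (hA : ∀ v, A (J v) = 0) :
    A = 0 := by
  obtain ⟨T, hT⟩ := exists_real_add_imaginary hdim hJ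
  ext w
  have : w = J (T w).1 + Complex.I • J (T w).2 := T.injective (by rw [hT])
  rw [this, map_add, map_smul, hA, hA]
  simp

/-- A function that is complex differentiable near a point of a maximal totally real subspace and
vanishes on that subspace vanishes near the point. It is enough to look at the complex lines
`t ↦ J a + t • J b`, which meet the subspace in the real values of `t`. -/
theorem eventually_eq_zero_of_totallyReal {Y : Type*} [NormedAddCommGroup Y] [NormedSpace ℂ Y]
    [CompleteSpace Y]
    (hdim : Module.finrank ℂ W = Module.finrank ℝ V)
    (hJ : ∀ v w, J v = Complex.I • J w → v = 0) {h : W → Y} {c : V}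
    (hd : ∀ᶠ w in 𝓝 (J c), DifferentiableAt ℂ h w) (h0 : ∀ᶠ v in 𝓝 c, h (J v) = 0) :
    ∀ᶠ w in 𝓝 (J c), h w = 0 := by
  obtain ⟨T, hT⟩ := exists_real_add_imaginary hdim hJ
  obtain ⟨r, hr, hd⟩ := Metric.eventually_nhds_iff_ball.1 hd
  have hTc : T (J c) = (c, 0) := by simpa using hT c 0
  have hev : ∀ᶠ w in 𝓝 (J c), ‖J (T w).1 - J c‖ + 2 * ‖J (T w).2‖ < r ∧
      ∀ᶠ v in 𝓝 (T w).1, h (J v) = 0 := by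
    refine Filter.Eventually.and ?_ ?_
    · have : ContinuousAt (fun w => ‖J (T w).1 - J c‖ + 2 * ‖J (T w).2‖) (J c) := by fun_prop
      refine this.eventually_lt continuousAt_const ?_
      simpa [hTc] using hr
    · have : ContinuousAt (fun w => (T w).1) (J c) := by fun_prop
      have h2 := this.eventually (p := fun a => ∀ᶠ v in 𝓝 a, h (J v) = 0)
      simp only [hTc] at h2
      exact h2 h0.eventually_nhds
  filter_upwards [hev] with w ⟨hw1, hw2⟩
  set a := (T w).1
  set b := (T w).2
  have hw : w = J a + Complex.I • J b := T.injective (by rw [hT])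
  let k : ℂ → Y := fun t => h (J a + t • J b)
  have hk : DifferentiableOn ℂ k (Metric.ball 0 2) := by
    intro t ht
    refine DifferentiableAt.differentiableWithinAt ?_
    have hmem : J a + t • J b ∈ Metric.ball (J c) r := by
      rw [mem_ball_iff_norm]
      rw [mem_ball_zero_iff] at ht
      calc ‖J a + t • J b - J c‖ = ‖(J a - J c) + t • J b‖ := by congr 1; abel
        _ ≤ ‖J a - J c‖ + ‖t‖ * ‖J b‖ := by
            rw [← norm_smul]; exact norm_add_le _ _
        _ ≤ ‖J a - J c‖ + 2 * ‖J b‖ := by gcongr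
        _ < r := hw1
    exact (hd _ hmem).comp (f := fun t : ℂ => J a + t • J b) t (by fun_prop)
  have hk2 := hk.analyticOnNhd Metric.isOpen_ball
  have hfreq : ∃ᶠ t in 𝓝[≠] (0 : ℂ), k t = 0 := by
    have hreal : ∀ᶠ s : ℝ in 𝓝[≠] 0, k (s : ℂ) = 0 := by
      have hc : ContinuousAt (fun s : ℝ => a + s • b) 0 := by fun_prop
      have h3 := hc.eventually (p := fun v => h (J v) = 0) (by simpa using hw2)
      refine (h3.filter_mono nhdsWithin_le_nhds).mono fun s hs => ?_
      change h (J a + (s : ℂ) • J b) = 0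
      rw [map_add, map_smul] at hs
      exact hs
    have ht : Tendsto (fun s : ℝ => (s : ℂ)) (𝓝[≠] 0) (𝓝[≠] 0) := by
      refine tendsto_nhdsWithin_iff.2 ⟨?_, ?_⟩
      · exact (Complex.continuous_ofReal.tendsto' 0 0 (by simp)).mono_left nhdsWithin_le_nhds
      · filter_upwards [self_mem_nhdsWithin] with s hs
        simpa using hs
    exact ht.frequently hreal.frequently
  have := hk2.eqOn_zero_of_preconnected_of_frequently_eq_zero
    (convex_ball (0 : ℂ) 2).isPreconnected (by simp) hfreq
    (show Complex.I ∈ Metric.ball (0 : ℂ) 2 by simp)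
  rw [hw]
  exact this

end TotallyReal

end Complexification

/-! ### The identity theorem for analytic maps between manifolds -/

theorem contMDiffAt_real {W : Type*} [NormedAddCommGroup W] [NormedSpace ℂ W]
    {E : Type*} [NormedAddCommGroup E] [NormedSpace ℂ E]
    {X : Type*} [TopologicalSpace X] [ChartedSpace W X]
    {Y : Type*} [TopologicalSpace Y] [ChartedSpace E Y] {n : ℕ∞ω} {f : X → Y} {x : X}
    (hf : ContMDiffAt 𝓘(ℂ, W) 𝓘(ℂ, E) n f x) : ContMDiffAt 𝓘(ℝ, W) 𝓘(ℝ, E) n f x := by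
  rw [contMDiffAt_iff] at *
  exact ⟨hf.1, hf.2.restrict_scalars ℝ⟩

/-- Two analytic maps into a Hausdorff manifold that agree near one point of a preconnected set
agree on the whole set. -/
theorem eqOn_of_eventuallyEq {B : Type*} [NormedAddCommGroup B] [NormedSpace ℝ B]
    {E : Type*} [NormedAddCommGroup E] [NormedSpace ℝ E] [CompleteSpace E]
    {X : Type*} [TopologicalSpace X] [ChartedSpace B X] [IsManifold 𝓘(ℝ, B) ω X]
    {Y : Type*} [TopologicalSpace Y] [T2Space Y] [ChartedSpace E Y] [IsManifold 𝓘(ℝ, E) ω Y]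
    {f g : X → Y} {U : Set X} (hU : IsPreconnected U)
    (hf : ∀ y ∈ U, ContMDiffAt 𝓘(ℝ, B) 𝓘(ℝ, E) ω f y)
    (hg : ∀ y ∈ U, ContMDiffAt 𝓘(ℝ, B) 𝓘(ℝ, E) ω g y)
    {y₀ : X} (hy₀ : y₀ ∈ U) (h : f =ᶠ[𝓝 y₀] g) : Set.EqOn f g U := by
  set S : Set X := {y | f =ᶠ[𝓝 y] g}
  have hS : IsOpen S := isOpen_setOfPred_eventually_nhds
  suffices U ⊆ S from fun y hy => (this hy).self_of_nhds
  refine hU.subset_of_closure_inter_subset hS ⟨y₀, hy₀, h⟩ ?_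
  rintro y ⟨hyS, hyU⟩
  have hfy := hf y hyU
  have hgy := hg y hyU
  have hval : f y = g y := by
    have : (𝓝[S] y).NeBot := mem_closure_iff_nhdsWithin_neBot.1 hyS
    refine tendsto_nhds_unique (f := f) (l := 𝓝[S] y)
      (hfy.continuousAt.tendsto.mono_left nhdsWithin_le_nhds)
      ((hgy.continuousAt.tendsto.mono_left nhdsWithin_le_nhds).congr' ?_)
    filter_upwards [self_mem_nhdsWithin] with z hz
    exact (Filter.Eventually.self_of_nhds hz).symm
  let C := chartAt B y
  let D := chartAt E (f y)
  have key : ∀ {k : X → Y}, ContMDiffAt 𝓘(ℝ, B) 𝓘(ℝ, E) ω k y → k y = f y →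
      AnalyticAt ℝ (fun w => D (k (C.symm w))) (C y) := by
    intro k hk hkf
    have h2 := (contMDiffAt_iff.1 hk).2
    rw [hkf] at h2
    simp only [modelWithCornersSelf_coe, Set.range_id, contDiffWithinAt_univ] at h2
    exact ContDiffAt.analyticAt h2
  have hfa := key hfy rfl
  have hga := key hgy hval.symm
  obtain ⟨r, hr, hball⟩ := Metric.eventually_nhds_iff_ball.1
    ((hfa.eventually_analyticAt.and hga.eventually_analyticAt).and
      (C.open_target.mem_nhds (mem_chart_target B y)))
  -- a point near `y` at which the two maps have the same germ
  have hnear : ∀ᶠ z in 𝓝 y, z ∈ C.source ∧ C z ∈ Metric.ball (C y) r :=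
    Filter.Eventually.and (C.open_source.mem_nhds (mem_chart_source B y))
      ((C.continuousAt (mem_chart_source B y)).eventually (Metric.ball_mem_nhds _ hr))
  obtain ⟨z, ⟨hz1, hz2⟩, hzS⟩ := (hnear.and_frequently
    (mem_closure_iff_frequently.1 hyS)).exists
  have hev : (fun w => D (f (C.symm w))) =ᶠ[𝓝 (C z)] fun w => D (g (C.symm w)) := by
    have hc : ContinuousAt C.symm (C z) := C.continuousAt_symm (C.map_source hz1)
    have hzS' : ∀ᶠ u in 𝓝 (C.symm (C z)), f u = g u := by
      rw [C.left_inv hz1]; exact hzS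
    filter_upwards [hc.eventually hzS'] with w hw
    rw [hw]
  have heq := AnalyticOnNhd.eqOn_of_preconnected_of_eventuallyEq
    (fun w hw => (hball w hw).1.1) (fun w hw => (hball w hw).1.2)
    (convex_ball (C y) r).isPreconnected hz2 hev
  have hfs : ∀ᶠ z in 𝓝 y, f z ∈ D.source :=
    hfy.continuousAt.eventually (D.open_source.mem_nhds (mem_chart_source E (f y)))
  have hgs : ∀ᶠ z in 𝓝 y, g z ∈ D.source :=
    hgy.continuousAt.eventually (D.open_source.mem_nhds (by
      rw [← hval]; exact mem_chart_source E (f y)))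
  change ∀ᶠ z in 𝓝 y, f z = g z
  filter_upwards [hnear, hfs, hgs] with z hz hzf hzg
  refine D.injOn hzf hzg ?_
  have := heq hz.2
  simpa only [C.left_inv hz.1] using this

/-! ### Complex charts adapted to a totally real submanifold -/

section Adapted

variable {V : Type*} [NormedAddCommGroup V] [NormedSpace ℝ V]
  {M : Type*} [TopologicalSpace M] [ChartedSpace V M]
  {W : Type*} [NormedAddCommGroup W] [NormedSpace ℂ W]
  {N : Type*} [TopologicalSpace N] [ChartedSpace W N]
  {E : Type*} [NormedAddCommGroup E] [NormedSpace ℂ E]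
  {G : Type*} [TopologicalSpace G] [ChartedSpace E G]

variable (V W) in
/-- A holomorphic chart of `N` near `ι x₀` in which the embedding `ι : M → N` becomes, near `x₀`
and in the preferred chart of `M` at `x₀`, a totally real linear map. -/
structure AdaptedChart (ι : M → N) (x₀ : M) where
  /-- The linear map to which `ι` reduces. -/
  linear : V →L[ℝ] W
  /-- The chart of `N`. -/
  chart : OpenPartialHomeomorph N W
  totallyReal : ∀ v w, linear v = Complex.I • linear w → v = 0
  mem_source : ι x₀ ∈ chart.source
  contMDiffAt : ∀ y ∈ chart.source, ContMDiffAt 𝓘(ℂ, W) 𝓘(ℂ, W) ω chart y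
  contMDiffAt_symm : ∀ w ∈ chart.target, ContMDiffAt 𝓘(ℂ, W) 𝓘(ℂ, W) ω chart.symm w
  chart_apply : ∀ᶠ x in 𝓝 x₀, chart (ι x) = linear (chartAt V x₀ x)

/-- Adapted charts exist: the embedding, read in charts, extends to a holomorphic germ `W → W`
whose differential is the identity, and this germ straightens the submanifold. -/
theorem nonempty_adaptedChart [FiniteDimensional ℝ V] [FiniteDimensional ℂ W]
    [IsManifold 𝓘(ℂ, W) ω N] (hdim : Module.finrank ℂ W = Module.finrank ℝ V)
    {ι : M → N} {x₀ : M} (hι : ContMDiffAt 𝓘(ℝ, V) 𝓘(ℝ, W) ω ι x₀)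
    (htr : ∀ v w, differential V W ι x₀ v = Complex.I • differential V W ι x₀ w → v = 0) :
    Nonempty (AdaptedChart V W ι x₀) := by
  have : CompleteSpace W := FiniteDimensional.complete ℂ W
  let J : V →L[ℝ] W := differential V W ι x₀
  let CM := chartAt V x₀
  let CN := chartAt W (ι x₀)
  let c : V := CM x₀
  let f : V → W := fun v => CN (ι (CM.symm v))
  have hf : AnalyticAt ℝ f c := by
    have h2 := (contMDiffAt_iff.1 hι).2
    simp only [modelWithCornersSelf_coe, Set.range_id, contDiffWithinAt_univ] at h2
    exact ContDiffAt.analyticAt h2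
  have hfJ : HasFDerivAt f J c := by
    have h2 := (hι.mdifferentiableAt (by simp)).hasMFDerivAt.2
    simp only [modelWithCornersSelf_coe, Set.range_id] at h2
    exact hasFDerivWithinAt_univ.1 h2
  obtain ⟨g, hg, hgf⟩ := exists_complexification
    (hasComplexCoordinates_of_totallyReal hdim htr) hf
  have hgd : HasFDerivAt g (ContinuousLinearEquiv.refl ℂ W : W →L[ℂ] W) (J c) := by
    have h1 := hg.differentiableAt.hasFDerivAt
    have h2 : HasFDerivAt f (((fderiv ℂ g (J c)).restrictScalars ℝ).comp J) c :=
      ((h1.restrictScalars ℝ).comp c J.hasFDerivAt).congr_of_eventuallyEq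
        (hgf.mono fun v hv => hv.symm)
    have h3 : fderiv ℂ g (J c) - ContinuousLinearMap.id ℂ W = 0 := by
      refine clm_eq_zero_of_comp_totallyReal hdim htr fun v => ?_
      have := congrArg (fun A : V →L[ℝ] W => A v) (h2.unique hfJ)
      simpa [sub_eq_zero] using this
    rw [sub_eq_zero] at h3
    rw [h3] at h1
    exact h1
  have hgc : ContDiffAt ℂ ω g (J c) := hg.contDiffAt
  let e := hgc.toOpenPartialHomeomorph g hgd (by simp)
  have hec : J c ∈ e.source := hgc.mem_toOpenPartialHomeomorph_source hgd (by simp)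
  have hegc : g (J c) = CN (ι x₀) := by
    rw [hgf.self_of_nhds]
    simp [f, c, CM.left_inv (mem_chart_source V x₀)]
  have hect : CN (ι x₀) ∈ e.target := by
    rw [← hegc]; exact e.map_source hec
  have heJ : e.symm (CN (ι x₀)) = J c := by
    rw [← hegc]; exact e.left_inv hec
  let φ₀ : OpenPartialHomeomorph N W := CN.trans e.symm
  have hφ₀ : ι x₀ ∈ φ₀.source := by
    rw [OpenPartialHomeomorph.trans_source]
    exact ⟨mem_chart_source W _, hect⟩
  have hsm : ContMDiffAt 𝓘(ℂ, W) 𝓘(ℂ, W) ω φ₀ (ι x₀) := by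
    have h1 : ContMDiffAt 𝓘(ℂ, W) 𝓘(ℂ, W) ω CN (ι x₀) :=
      contMDiffAt_of_mem_maximalAtlas (IsManifold.chart_mem_maximalAtlas _) (mem_chart_source W _)
    have h2 : ContMDiffAt 𝓘(ℂ, W) 𝓘(ℂ, W) ω e.symm (CN (ι x₀)) := by
      rw [contMDiffAt_iff_contDiffAt, ← hegc]
      exact hgc.to_localInverse hgd (by simp)
    exact h2.comp _ h1
  have hφ₀c : φ₀ (ι x₀) = J c := heJ
  have hsms : ContMDiffAt 𝓘(ℂ, W) 𝓘(ℂ, W) ω φ₀.symm (φ₀ (ι x₀)) := by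
    rw [hφ₀c]
    have h1 : ContMDiffAt 𝓘(ℂ, W) 𝓘(ℂ, W) ω CN.symm (g (J c)) := by
      rw [hegc]
      exact contMDiffAt_symm_of_mem_maximalAtlas (IsManifold.chart_mem_maximalAtlas _)
        (mem_chart_target W _)
    exact h1.comp (J c) hgc.contMDiffAt
  have hev : ∀ᶠ y in 𝓝 (ι x₀), ContMDiffAt 𝓘(ℂ, W) 𝓘(ℂ, W) ω φ₀ y ∧
      ContMDiffAt 𝓘(ℂ, W) 𝓘(ℂ, W) ω φ₀.symm (φ₀ y) :=
    (((contMDiffAt_iff_contMDiffAt_nhds (by simp)).1 hsm)).and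
      (hsm.continuousAt.eventually ((contMDiffAt_iff_contMDiffAt_nhds (by simp)).1 hsms))
  obtain ⟨t, ht, hto, hxt⟩ := eventually_nhds_iff.1 hev
  let φ := φ₀.restrOpen t hto
  refine ⟨⟨J, φ, htr, ⟨hφ₀, hxt⟩, fun y hy => (ht y hy.2).1, fun w hw => ?_, ?_⟩⟩
  · have h1 : φ.symm w ∈ φ.source := φ.map_target hw
    have := (ht _ h1.2).2
    have h3 : φ₀ (φ.symm w) = w := φ.right_inv hw
    rw [h3] at this
    exact this
  · have h1 : ∀ᶠ x in 𝓝 x₀, x ∈ CM.source := CM.open_source.mem_nhds (mem_chart_source V x₀)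
    have hCM : ContinuousAt CM x₀ := CM.continuousAt (mem_chart_source V x₀)
    have h2 : ∀ᶠ x in 𝓝 x₀, g (J (CM x)) = f (CM x) := hCM.eventually hgf
    have h3 : ∀ᶠ x in 𝓝 x₀, J (CM x) ∈ e.source :=
      (J.continuous.continuousAt.comp hCM).eventually (e.open_source.mem_nhds hec)
    filter_upwards [h1, h2, h3] with x hx1 hx2 hx3
    change e.symm (CN (ι x)) = J (CM x)
    have : CN (ι x) = e (J (CM x)) := by
      change _ = g (J (CM x))
      rw [hx2]
      simp [f, CM.left_inv hx1]
    rw [this, e.left_inv hx3]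

namespace AdaptedChart

variable {ι : M → N} {x₀ : M} (A : AdaptedChart V W ι x₀)

theorem chart_base : A.chart (ι x₀) = A.linear (chartAt V x₀ x₀) := A.chart_apply.self_of_nhds

/-- In the parametrization of `N` inverse to an adapted chart, the totally real subspace
parametrizes the submanifold. -/
theorem eventually_symm_apply (hι : ContinuousAt ι x₀) :
    ∀ᶠ v in 𝓝 (chartAt V x₀ x₀), A.linear v ∈ A.chart.target ∧
      A.chart.symm (A.linear v) = ι ((chartAt V x₀).symm v) := by
  let C := chartAt V x₀
  have hc : ContinuousAt C.symm (C x₀) := C.continuousAt_symm (mem_chart_target V x₀)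
  have hx : C.symm (C x₀) = x₀ := C.left_inv (mem_chart_source V x₀)
  have h1 : ∀ᶠ x in 𝓝 (C.symm (C x₀)), A.chart (ι x) = A.linear (C x) ∧ ι x ∈ A.chart.source := by
    rw [hx]
    exact A.chart_apply.and (hι.eventually (A.chart.open_source.mem_nhds A.mem_source))
  filter_upwards [hc.eventually h1, C.open_target.mem_nhds (mem_chart_target V x₀)] with v hv hvt
  have : A.linear v = A.chart (ι (C.symm v)) := by
    rw [hv.1, C.right_inv hvt]
  rw [this]
  exact ⟨A.chart.map_source hv.2, A.chart.left_inv hv.2⟩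

/-- Two holomorphic maps that agree on the submanifold near `x₀` agree near `ι x₀`. -/
theorem eventuallyEq_of_comp (A : AdaptedChart V W ι x₀) [FiniteDimensional ℝ V] [FiniteDimensional ℂ W] [CompleteSpace E]
    [IsManifold 𝓘(ℂ, E) ω G]
    (hdim : Module.finrank ℂ W = Module.finrank ℝ V) (hι : ContinuousAt ι x₀) {f g : N → G}
    (hf : ∀ᶠ y in 𝓝 (ι x₀), MDifferentiableAt 𝓘(ℂ, W) 𝓘(ℂ, E) f y)
    (hg : ∀ᶠ y in 𝓝 (ι x₀), MDifferentiableAt 𝓘(ℂ, W) 𝓘(ℂ, E) g y)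
    (h : ∀ᶠ x in 𝓝 x₀, f (ι x) = g (ι x)) : f =ᶠ[𝓝 (ι x₀)] g := by
  have : IsManifold 𝓘(ℂ, E) 1 G := .of_le (n := ω) (by simp)
  let φ := A.chart
  let D := chartAt E (f (ι x₀))
  have hval : f (ι x₀) = g (ι x₀) := h.self_of_nhds
  have hsymm : ContinuousAt φ.symm (φ (ι x₀)) := φ.continuousAt_symm (φ.map_source A.mem_source)
  have hback : φ.symm (φ (ι x₀)) = ι x₀ := φ.left_inv A.mem_source
  have key : ∀ {k : N → G}, (∀ᶠ y in 𝓝 (ι x₀), MDifferentiableAt 𝓘(ℂ, W) 𝓘(ℂ, E) k y) →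
      k (ι x₀) = f (ι x₀) → (∀ᶠ y in 𝓝 (ι x₀), k y ∈ D.source) ∧
      ∀ᶠ w in 𝓝 (φ (ι x₀)), DifferentiableAt ℂ (fun w => D (k (φ.symm w))) w := by
    intro k hk hkf
    have hs : ∀ᶠ y in 𝓝 (ι x₀), k y ∈ D.source :=
      hk.self_of_nhds.continuousAt.eventually (D.open_source.mem_nhds (by
        rw [hkf]; exact mem_chart_source E _))
    refine ⟨hs, ?_⟩
    have h1 : ∀ᶠ y in 𝓝 (φ.symm (φ (ι x₀))),
        k y ∈ D.source ∧ MDifferentiableAt 𝓘(ℂ, W) 𝓘(ℂ, E) k y := by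
      rw [hback]; exact hs.and hk
    filter_upwards [hsymm.eventually h1,
      φ.open_target.mem_nhds (φ.map_source A.mem_source)] with w hw hwt
    rw [← mdifferentiableAt_iff_differentiableAt]
    have h2 : MDifferentiableAt 𝓘(ℂ, E) 𝓘(ℂ, E) D (k (φ.symm w)) :=
      mdifferentiableAt_atlas (chart_mem_atlas E _) hw.1
    have h3 : MDifferentiableAt 𝓘(ℂ, W) 𝓘(ℂ, W) φ.symm w :=
      (A.contMDiffAt_symm w hwt).mdifferentiableAt (by simp)
    exact h2.comp w (hw.2.comp w h3)
  obtain ⟨hfs, hfd⟩ := key hf rfl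
  obtain ⟨hgs, hgd⟩ := key hg hval.symm
  have hz : ∀ᶠ w in 𝓝 (A.linear (chartAt V x₀ x₀)),
      D (f (φ.symm w)) - D (g (φ.symm w)) = 0 := by
    rw [A.chart_base] at hfd hgd
    refine eventually_eq_zero_of_totallyReal hdim A.totallyReal
      ((hfd.and hgd).mono fun w hw => hw.1.sub hw.2) ?_
    have hc := (chartAt V x₀).continuousAt_symm (mem_chart_target V x₀)
    have h1 : ∀ᶠ x in 𝓝 ((chartAt V x₀).symm (chartAt V x₀ x₀)), f (ι x) = g (ι x) := by
      rw [(chartAt V x₀).left_inv (mem_chart_source V x₀)]; exact h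
    filter_upwards [A.eventually_symm_apply hι, hc.eventually h1] with v hv hv2
    rw [hv.2, hv2, sub_self]
  rw [← A.chart_base] at hz
  filter_upwards [hfs, hgs, (φ.continuousAt A.mem_source).eventually hz,
    φ.open_source.mem_nhds A.mem_source] with y h1 h2 h3 h4
  rw [φ.left_inv h4, sub_eq_zero] at h3
  exact D.injOn h1 h2 h3

end AdaptedChart

end Adapted

/-! ### Local holomorphic extension of an analytic family of loops -/

section LocalExtension

variable {V : Type*} [NormedAddCommGroup V] [NormedSpace ℝ V]
  {M : Type*} [TopologicalSpace M] [ChartedSpace V M]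
  {W : Type*} [NormedAddCommGroup W] [NormedSpace ℂ W]
  {N : Type*} [TopologicalSpace N] [ChartedSpace W N]
  {E : Type*} [NormedAddCommGroup E] [NormedSpace ℂ E]
  {G : Type*} [TopologicalSpace G] [ChartedSpace E G]

namespace AdaptedChart

variable {ι : M → N} {x₀ : M} (A : AdaptedChart V W ι x₀)

/-- The coordinate ball of radius `r` about `ι x₀` in an adapted chart. It is only meaningful when
the ball of radius `r` in `W` is contained in the target of the chart. -/
def ball (r : ℝ) : Set N := A.chart.symm '' Metric.ball (A.chart (ι x₀)) r

theorem isOpen_ball {r : ℝ} (hr : Metric.ball (A.chart (ι x₀)) r ⊆ A.chart.target) :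
    IsOpen (A.ball r) :=
  A.chart.isOpen_image_symm_of_subset_target Metric.isOpen_ball hr

theorem isPreconnected_ball {r : ℝ} (hr : Metric.ball (A.chart (ι x₀)) r ⊆ A.chart.target) :
    IsPreconnected (A.ball r) :=
  (convex_ball _ r).isPreconnected.image _ (A.chart.continuousOn_symm.mono hr)

theorem mem_ball {r : ℝ} (hr : 0 < r) : ι x₀ ∈ A.ball r :=
  ⟨_, Metric.mem_ball_self hr, A.chart.left_inv A.mem_source⟩

theorem exists_ball_subset {s : Set N} (hs : s ∈ 𝓝 (ι x₀)) :
    ∃ r > 0, Metric.ball (A.chart (ι x₀)) r ⊆ A.chart.target ∧ A.ball r ⊆ s := by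
  have hc := A.chart.continuousAt_symm (A.chart.map_source A.mem_source)
  rw [ContinuousAt, A.chart.left_inv A.mem_source] at hc
  obtain ⟨r, hr, h⟩ := Metric.mem_nhds_iff.1
    (Filter.inter_mem (A.chart.open_target.mem_nhds (A.chart.map_source A.mem_source)) (hc hs))
  refine ⟨r, hr, fun w hw => (h hw).1, ?_⟩
  rintro _ ⟨w, hw, rfl⟩
  exact (h hw).2

end AdaptedChart

variable (V W E) in
/-- The family `f` of maps on `N` is, on the set `U` and for loop parameters in `B`, a
holomorphic extension of the family `F` on the submanifold. -/
structure IsLocalExtension (ι : M → N) (F : M → Circle → G) (U : Set N) (B : Set Circle)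
    (f : N → Circle → G) : Prop where
  analytic : ∀ y ∈ U, ∀ z ∈ B,
    ContMDiffAt (𝓘(ℝ, W).prod (𝓡 1)) 𝓘(ℝ, E) ω (fun q : N × Circle => f q.1 q.2) (y, z)
  holomorphic : ∀ y ∈ U, ∀ z ∈ B, ContMDiffAt 𝓘(ℂ, W) 𝓘(ℂ, E) ω (fun y => f y z) y
  apply_eq : ∀ x, ι x ∈ U → ∀ z ∈ B, f (ι x) z = F x z

theorem IsLocalExtension.mono {M : Type*} {ι : M → N} {F : M → Circle → G} {U U' : Set N} {B B' : Set Circle}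
    {f : N → Circle → G} (h : IsLocalExtension W E ι F U B f) (hU : U' ⊆ U) (hB : B' ⊆ B) :
    IsLocalExtension W E ι F U' B' f :=
  ⟨fun y hy z hz => h.analytic y (hU hy) z (hB hz),
    fun y hy z hz => h.holomorphic y (hU hy) z (hB hz),
    fun x hx z hz => h.apply_eq x (hU hx) z (hB hz)⟩

/-- Holomorphic maps on a preconnected open set meeting the submanifold are determined by their
values on the submanifold. -/
theorem AdaptedChart.eqOn_of_comp {ι : M → N} {x₀ : M} (A : AdaptedChart V W ι x₀)
    [FiniteDimensional ℝ V] [FiniteDimensional ℂ W] [CompleteSpace E]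
    [IsManifold 𝓘(ℂ, E) ω G] [IsManifold 𝓘(ℂ, W) ω N] [T2Space G]
    (hdim : Module.finrank ℂ W = Module.finrank ℝ V) (hι : ContinuousAt ι x₀)
    {U : Set N} (hUo : IsOpen U) (hU : IsPreconnected U) (hx₀ : ι x₀ ∈ U) {f g : N → G}
    (hf : ∀ y ∈ U, MDifferentiableAt 𝓘(ℂ, W) 𝓘(ℂ, E) f y)
    (hg : ∀ y ∈ U, MDifferentiableAt 𝓘(ℂ, W) 𝓘(ℂ, E) g y)
    (hf' : ∀ y ∈ U, ContMDiffAt 𝓘(ℝ, W) 𝓘(ℝ, E) ω f y)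
    (hg' : ∀ y ∈ U, ContMDiffAt 𝓘(ℝ, W) 𝓘(ℝ, E) ω g y)
    (h : ∀ x, ι x ∈ U → f (ι x) = g (ι x)) : Set.EqOn f g U := by
  have : IsManifold 𝓘(ℝ, W) ω N := isManifold_real
  have : IsManifold 𝓘(ℝ, E) ω G := isManifold_real
  have hev : ∀ᶠ y in 𝓝 (ι x₀), y ∈ U := hUo.mem_nhds hx₀
  exact eqOn_of_eventuallyEq hU hf' hg' hx₀
    (A.eventuallyEq_of_comp hdim hι (hev.mono hf) (hev.mono hg) ((hι.eventually hev).mono h))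

theorem AdaptedChart.localExtension_unique {ι : M → N} {x₀ : M} (A : AdaptedChart V W ι x₀)
    [FiniteDimensional ℝ V] [FiniteDimensional ℂ W] [CompleteSpace E]
    [IsManifold 𝓘(ℂ, E) ω G] [IsManifold 𝓘(ℂ, W) ω N] [T2Space G]
    (hdim : Module.finrank ℂ W = Module.finrank ℝ V) (hι : ContinuousAt ι x₀)
    {U : Set N} (hUo : IsOpen U) (hU : IsPreconnected U) (hx₀ : ι x₀ ∈ U)
    {F : M → Circle → G} {B B' : Set Circle} {f g : N → Circle → G}
    (hf : IsLocalExtension W E ι F U B f) (hg : IsLocalExtension W E ι F U B' g)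
    {y : N} (hy : y ∈ U) {z : Circle} (hz : z ∈ B) (hz' : z ∈ B') : f y z = g y z := by
  refine A.eqOn_of_comp hdim hι hUo hU hx₀ (f := fun y => f y z) (g := fun y => g y z)
    (fun y hy => (hf.holomorphic y hy z hz).mdifferentiableAt (by simp))
    (fun y hy => (hg.holomorphic y hy z hz').mdifferentiableAt (by simp))
    (fun y hy => contMDiffAt_real (hf.holomorphic y hy z hz))
    (fun y hy => contMDiffAt_real (hg.holomorphic y hy z hz')) (fun x hx => ?_) hy
  rw [hf.apply_eq x hx z hz, hg.apply_eq x hx z hz']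

/-- The real form `ℝ ⊂ ℂ` of the loop parameter is adjoined to a totally real subspace. -/
theorem HasComplexCoordinates.prod {J : V →L[ℝ] W} (h : HasComplexCoordinates J) :
    HasComplexCoordinates (J.prodMap
      (Complex.ofRealCLM.comp (EuclideanSpace.proj (0 : Fin 1) : EuclideanSpace ℝ (Fin 1) →L[ℝ] ℝ)))
    := by
  obtain ⟨m, e, ℓ, h⟩ := h
  refine ⟨m + 1, Fin.cons (0, EuclideanSpace.single 0 1) (fun k => (e k, 0)),
    Fin.cons (ContinuousLinearMap.snd ℂ W ℂ) (fun k => (ℓ k).comp (ContinuousLinearMap.fst ℂ W ℂ)),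
    ?_⟩
  rintro ⟨v, t⟩
  obtain ⟨r, hv, hl⟩ := h v
  refine ⟨Fin.cons (t 0) r, ?_, fun k => ?_⟩
  · rw [Fin.sum_univ_succ]
    ext i
    · simpa [Prod.fst_sum] using hv
    · have : i = 0 := Subsingleton.elim _ _
      subst this
      simp [Prod.snd_sum]
  · refine Fin.cases ?_ (fun k => ?_) k
    · simp
    · simpa using hl k

theorem AdaptedChart.exists_localExtension_near {ι : M → N} {x₀ : M} (A : AdaptedChart V W ι x₀)
    [FiniteDimensional ℝ V] [FiniteDimensional ℂ W] [CompleteSpace E]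
    [IsManifold 𝓘(ℂ, E) ω G]
    (hdim : Module.finrank ℂ W = Module.finrank ℝ V) (hι : IsInducing ι)
    {F : M → Circle → G} (hF : IsAnalyticLoopMap V E F) (z₀ : Circle) :
    ∃ (U : Set N) (B : Set Circle) (f : N → Circle → G), IsOpen U ∧ ι x₀ ∈ U ∧ IsOpen B ∧ z₀ ∈ B ∧
      IsLocalExtension W E ι F U B f := by
  let T := EuclideanSpace ℝ (Fin 1)
  let CM := chartAt V x₀
  let CT := chartAt T z₀
  let D := chartAt E (F x₀ z₀)
  let L : T →L[ℝ] ℂ := Complex.ofRealCLM.comp (EuclideanSpace.proj (0 : Fin 1))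
  let J : V × T →L[ℝ] W × ℂ := A.linear.prodMap L
  have hCMx : CM.symm (CM x₀) = x₀ := CM.left_inv (mem_chart_source V x₀)
  have hCTz : CT.symm (CT z₀) = z₀ := CT.left_inv (mem_chart_source T z₀)
  have han : AnalyticAt ℝ (fun q : V × T => D (F (CM.symm q.1) (CT.symm q.2))) (CM x₀, CT z₀) := by
    have h2 := (contMDiffAt_iff.1 (hF (x₀, z₀))).2
    have hr : Set.range (𝓘(ℝ, V).prod (𝓡 1)) = Set.univ := by simp
    rw [hr, contDiffWithinAt_univ] at h2
    exact ContDiffAt.analyticAt h2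
  obtain ⟨g, hg, hgF⟩ := exists_complexification
    (hasComplexCoordinates_of_totallyReal hdim A.totallyReal).prod han
  replace hg : AnalyticAt ℂ g (J (CM x₀, CT z₀)) := hg
  replace hgF : ∀ᶠ q in 𝓝 (CM x₀, CT z₀), g (J q) = D (F (CM.symm q.1) (CT.symm q.2)) := hgF
  let K : N × Circle → W × ℂ := fun q => (A.chart q.1, L (CT q.2))
  have hK0 : K (ι x₀, z₀) = J (CM x₀, CT z₀) := by
    simp only [K, J, A.chart_base]
    rfl
  have hgK0 : g (K (ι x₀, z₀)) = D (F x₀ z₀) := by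
    rw [hK0, hgF.self_of_nhds]
    simp only [hCMx, hCTz]
  have hKs : ∀ q : N × Circle, q.1 ∈ A.chart.source → q.2 ∈ CT.source →
      ContMDiffAt (𝓘(ℝ, W).prod (𝓡 1)) 𝓘(ℝ, W × ℂ) ω K q := by
    intro q h1 h2
    refine ContMDiffAt.prodMk_space ?_ ?_
    · exact (contMDiffAt_real (A.contMDiffAt q.1 h1)).comp q contMDiffAt_fst
    · have h3 : ContMDiffAt (𝓡 1) 𝓘(ℝ, T) ω CT q.2 :=
        contMDiffAt_of_mem_maximalAtlas (IsManifold.chart_mem_maximalAtlas _) h2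
      have h4 : ContMDiffAt (𝓡 1) 𝓘(ℝ, ℂ) ω (fun z => L (CT z)) q.2 :=
        L.contMDiff.contMDiffAt.comp q.2 h3
      exact h4.comp q contMDiffAt_snd
  have hev1 : ∀ᶠ q : N × Circle in 𝓝 (ι x₀, z₀), q.1 ∈ A.chart.source ∧ q.2 ∈ CT.source :=
    (continuousAt_fst.eventually (A.chart.open_source.mem_nhds A.mem_source)).and
      (continuousAt_snd.eventually (CT.open_source.mem_nhds (mem_chart_source T z₀)))
  have hKc : ContinuousAt K (ι x₀, z₀) := (hKs _ A.mem_source (mem_chart_source T z₀)).continuousAt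
  have hg0 : AnalyticAt ℂ g (K (ι x₀, z₀)) := by rw [hK0]; exact hg
  have hev2 : ∀ᶠ q : N × Circle in 𝓝 (ι x₀, z₀), AnalyticAt ℂ g (K q) ∧ g (K q) ∈ D.target :=
    hKc.eventually (hg0.eventually_analyticAt.and
      (hg0.continuousAt.eventually (D.open_target.mem_nhds (by
        rw [hgK0]; exact mem_chart_target E _))))
  obtain ⟨U, hU, hxU, B, hB, hzB, hUB⟩ : ∃ U : Set N, IsOpen U ∧ ι x₀ ∈ U ∧ ∃ B : Set Circle,
      IsOpen B ∧ z₀ ∈ B ∧ ∀ y ∈ U, ∀ z ∈ B, (y ∈ A.chart.source ∧ z ∈ CT.source) ∧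
        (AnalyticAt ℂ g (K (y, z)) ∧ g (K (y, z)) ∈ D.target) := by
    obtain ⟨U, B, hU, hx, hB, hz, h⟩ := mem_nhds_prod_iff'.1 (hev1.and hev2)
    exact ⟨U, hU, hx, B, hB, hz, fun y hy z hz => h (Set.mk_mem_prod hy hz)⟩
  have hev3 : ∀ᶠ q : M × Circle in 𝓝 (x₀, z₀), D.symm (g (K (ι q.1, q.2))) = F q.1 q.2 := by
    have h1 : ∀ᶠ q : M × Circle in 𝓝 (x₀, z₀), A.chart (ι q.1) = A.linear (CM q.1) ∧
        q.1 ∈ CM.source ∧ q.2 ∈ CT.source := by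
      have h3 : ∀ᶠ x in 𝓝 x₀, x ∈ CM.source := CM.open_source.mem_nhds (mem_chart_source V x₀)
      have h4 : ∀ᶠ z in 𝓝 z₀, z ∈ CT.source := CT.open_source.mem_nhds (mem_chart_source T z₀)
      rw [nhds_prod_eq]
      filter_upwards [A.chart_apply.prod_inl (𝓝 z₀), h3.prod_inl (𝓝 z₀), h4.prod_inr (𝓝 x₀)]
        with q hq1 hq2 hq3 using ⟨hq1, hq2, hq3⟩
    have hc : ContinuousAt (fun q : M × Circle => (CM q.1, CT q.2)) (x₀, z₀) :=
      ((CM.continuousAt (mem_chart_source V x₀)).comp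
        (x := ((x₀, z₀) : M × Circle)) continuousAt_fst).prodMk
        ((CT.continuousAt (mem_chart_source T z₀)).comp
        (x := ((x₀, z₀) : M × Circle)) continuousAt_snd)
    have h2 : ∀ᶠ q : M × Circle in 𝓝 (x₀, z₀), F q.1 q.2 ∈ D.source :=
      (hF (x₀, z₀)).continuousAt.eventually (D.open_source.mem_nhds (mem_chart_source E _))
    filter_upwards [h1, hc.eventually hgF, h2] with q hq1 hq2 hq3
    have : K (ι q.1, q.2) = J (CM q.1, CT q.2) := by
      simp only [K, J, hq1.1]
      rfl
    rw [this, hq2]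
    simp only [CM.left_inv hq1.2.1, CT.left_inv hq1.2.2, D.left_inv hq3]
  obtain ⟨U', B', hU', hxU', hB', hzB', hUB'⟩ := mem_nhds_prod_iff'.1 hev3
  obtain ⟨U'', hU'', rfl⟩ := hι.isOpen_iff.1 hU'
  refine ⟨U ∩ U'', B ∩ B', fun y z => D.symm (g (K (y, z))), hU.inter hU'', ⟨hxU, hxU'⟩,
    hB.inter hB', ⟨hzB, hzB'⟩, ?_, ?_, ?_⟩
  · rintro y ⟨hy, -⟩ z ⟨hz, -⟩
    obtain ⟨⟨h1, h2⟩, h3, h4⟩ := hUB y hy z hz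
    have hD : ContMDiffAt 𝓘(ℝ, E) 𝓘(ℝ, E) ω D.symm (g (K (y, z))) :=
      contMDiffAt_real (contMDiffAt_symm_of_mem_maximalAtlas
        (IsManifold.chart_mem_maximalAtlas (I := 𝓘(ℂ, E)) _) h4)
    have hgr : ContMDiffAt 𝓘(ℝ, W × ℂ) 𝓘(ℝ, E) ω g (K (y, z)) :=
      contMDiffAt_real (contMDiffAt_iff_contDiffAt.2 h3.contDiffAt)
    exact hD.comp (y, z) (hgr.comp (y, z) (hKs (y, z) h1 h2))
  · rintro y ⟨hy, -⟩ z ⟨hz, -⟩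
    obtain ⟨⟨h1, h2⟩, h3, h4⟩ := hUB y hy z hz
    have hD : ContMDiffAt 𝓘(ℂ, E) 𝓘(ℂ, E) ω D.symm (g (K (y, z))) :=
      contMDiffAt_symm_of_mem_maximalAtlas (IsManifold.chart_mem_maximalAtlas _) h4
    have hgr : ContMDiffAt 𝓘(ℂ, W × ℂ) 𝓘(ℂ, E) ω g (K (y, z)) :=
      contMDiffAt_iff_contDiffAt.2 h3.contDiffAt
    have hK : ContMDiffAt 𝓘(ℂ, W) 𝓘(ℂ, W × ℂ) ω (fun y => K (y, z)) y :=
      (A.contMDiffAt y h1).prodMk_space (contMDiffAt_const (c := L (CT z)))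
    exact hD.comp y (hgr.comp y hK)
  · rintro x ⟨-, hx⟩ z ⟨-, hz⟩
    exact hUB' (Set.mk_mem_prod hx hz : (x, z) ∈ (ι ⁻¹' U'') ×ˢ B')

/-- Local extensions over small arcs glue, by compactness of the circle and by uniqueness, to an
extension for all values of the loop parameter. -/
theorem AdaptedChart.exists_localExtension {ι : M → N} {x₀ : M} (A : AdaptedChart V W ι x₀)
    [FiniteDimensional ℝ V] [FiniteDimensional ℂ W] [CompleteSpace E]
    [IsManifold 𝓘(ℂ, E) ω G] [IsManifold 𝓘(ℂ, W) ω N] [T2Space G]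
    (hdim : Module.finrank ℂ W = Module.finrank ℝ V) (hι : IsInducing ι)
    {F : M → Circle → G} (hF : IsAnalyticLoopMap V E F) :
    ∃ (U : Set N) (f : N → Circle → G), IsOpen U ∧ ι x₀ ∈ U ∧
      IsLocalExtension W E ι F U Set.univ f := by
  choose U B f hU hxU hB hzB hf using A.exists_localExtension_near hdim hι hF
  obtain ⟨t, ht⟩ := isCompact_univ.elim_finite_subcover B hB
    (fun z _ => Set.mem_iUnion.2 ⟨z, hzB z⟩)
  have hnhds : (⋂ z ∈ t, U z) ∈ 𝓝 (ι x₀) :=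
    (Filter.biInter_finset_mem t).2 fun z _ => (hU z).mem_nhds (hxU z)
  obtain ⟨r, hr, hrt, hrU⟩ := A.exists_ball_subset hnhds
  have hcov : ∀ z : Circle, ∃ i ∈ t, z ∈ B i := fun z => by
    simpa using ht (Set.mem_univ z)
  choose k hkt hkB using hcov
  have hsub : ∀ i ∈ t, A.ball r ⊆ U i := fun i hi y hy => Set.mem_iInter₂.1 (hrU hy) i hi
  have hglue : ∀ y ∈ A.ball r, ∀ i ∈ t, ∀ z ∈ B i, f (k z) y z = f i y z := by
    intro y hy i hi z hz
    exact A.localExtension_unique hdim hι.continuous.continuousAt (A.isOpen_ball hrt)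
      (A.isPreconnected_ball hrt) (A.mem_ball hr)
      ((hf (k z)).mono (hsub _ (hkt z)) subset_rfl) ((hf i).mono (hsub i hi) subset_rfl) hy
      (hkB z) hz
  refine ⟨A.ball r, fun y z => f (k z) y z, A.isOpen_ball hrt, A.mem_ball hr, ?_, ?_, ?_⟩
  · intro y hy z _
    refine ((hf (k z)).analytic y (hsub _ (hkt z) hy) z (hkB z)).congr_of_eventuallyEq ?_
    have : A.ball r ×ˢ B (k z) ∈ 𝓝 (y, z) :=
      prod_mem_nhds ((A.isOpen_ball hrt).mem_nhds hy) ((hB _).mem_nhds (hkB z))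
    filter_upwards [this] with q hq
    exact hglue q.1 hq.1 _ (hkt z) q.2 hq.2
  · intro y hy z _
    exact (hf (k z)).holomorphic y (hsub _ (hkt z) hy) z (hkB z)
  · intro x hx z _
    exact (hf (k z)).apply_eq x (hsub _ (hkt z) hx) z (hkB z)

end LocalExtension

/-! ### The Maurer-Cartan form -/

section MaurerCartan

variable {V : Type*} [NormedAddCommGroup V] [NormedSpace ℝ V]
  {M : Type*} [TopologicalSpace M] [ChartedSpace V M]
  {W : Type*} [NormedAddCommGroup W] [NormedSpace ℂ W]
  {N : Type*} [TopologicalSpace N] [ChartedSpace W N]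
  {E : Type*} [NormedAddCommGroup E] [NormedSpace ℂ E]
  {G : Type*} [TopologicalSpace G] [ChartedSpace E G] [Group G] [LieGroup 𝓘(ℂ, E) ω G]

theorem maurerCartan_congr {G : Type*} [TopologicalSpace G] [ChartedSpace E G] [Group G] {X : Type*} [TopologicalSpace X] [ChartedSpace V X] {f g : X → G}
    {x : X} (h : f =ᶠ[𝓝 x] g) : maurerCartan V E f x = maurerCartan V E g x := by
  unfold maurerCartan differential
  have h' : (fun y => (f x)⁻¹ * f y) =ᶠ[𝓝 x] fun y => (g x)⁻¹ * g y := by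
    rw [h.self_of_nhds]
    exact h.mono fun y hy => by
      change (g x)⁻¹ * f y = (g x)⁻¹ * g y
      rw [hy]
  exact h'.mfderiv_eq

theorem maurerCartan_comp {V' : Type*} [NormedAddCommGroup V'] [NormedSpace ℝ V']
    {X' : Type*} [TopologicalSpace X'] [ChartedSpace V' X']
    {X : Type*} [TopologicalSpace X] [ChartedSpace V X]
    {f : X → G} {φ : X' → X} {x : X'} (hf : MDifferentiableAt 𝓘(ℝ, V) 𝓘(ℝ, E) f (φ x))
    (hφ : MDifferentiableAt 𝓘(ℝ, V') 𝓘(ℝ, V) φ x) (u : V') :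
    maurerCartan V' E (fun y => f (φ y)) x u
      = maurerCartan V E f (φ x) (differential V' V φ x u) := by
  have : LieGroup 𝓘(ℝ, E) ω G := lieGroup_real
  have hmul : MDifferentiableAt 𝓘(ℝ, E) 𝓘(ℝ, E) (fun a : G => (f (φ x))⁻¹ * a) (f (φ x)) :=
    (contMDiff_mul_left (I := 𝓘(ℝ, E)) (n := ω) (a := (f (φ x))⁻¹)).contMDiffAt.mdifferentiableAt
      (by simp)
  exact congrArg (fun A : V' →L[ℝ] E => A u)
    (mfderiv_comp x (hmul.comp (φ x) hf) hφ)

/-- The Maurer-Cartan form of a holomorphic map `g : W → G`, as a function with values in the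
complex linear maps: the derivative of left-translated `g` read in the chart at the identity. -/
def complexMaurerCartan (g : W → G) (w : W) : W →L[ℂ] E :=
  fderiv ℂ (fun w' => chartAt E (1 : G) ((g w)⁻¹ * g w')) w

theorem contDiffAt_chart_inv_mul {g : W → G} {w : W} (hg : ContMDiffAt 𝓘(ℂ, W) 𝓘(ℂ, E) ω g w) :
    ContDiffAt ℂ ω (fun q : W × W => chartAt E (1 : G) ((g q.1)⁻¹ * g q.2)) (w, w) := by
  rw [← contMDiffAt_iff_contDiffAt]
  have h1 : ContMDiffAt 𝓘(ℂ, W × W) 𝓘(ℂ, E) ω (fun q : W × W => g q.1) (w, w) :=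
    ContMDiffAt.comp (x := (w, w)) (I' := 𝓘(ℂ, W)) (f := Prod.fst) (g := g) hg
      contDiffAt_fst.contMDiffAt
  have h2 : ContMDiffAt 𝓘(ℂ, W × W) 𝓘(ℂ, E) ω (fun q : W × W => g q.2) (w, w) :=
    ContMDiffAt.comp (x := (w, w)) (I' := 𝓘(ℂ, W)) (f := Prod.snd) (g := g) hg
      contDiffAt_snd.contMDiffAt
  have h3 : ContMDiffAt 𝓘(ℂ, E) 𝓘(ℂ, E) ω (chartAt E (1 : G)) ((g w)⁻¹ * g w) := by
    rw [inv_mul_cancel]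
    exact contMDiffAt_of_mem_maximalAtlas (IsManifold.chart_mem_maximalAtlas _)
      (mem_chart_source E _)
  exact h3.comp (w, w) (h1.inv.mul h2)

theorem analyticAt_complexMaurerCartan [CompleteSpace E] {g : W → G} {w : W}
    (hg : ContMDiffAt 𝓘(ℂ, W) 𝓘(ℂ, E) ω g w) : AnalyticAt ℂ (complexMaurerCartan (E := E) g) w :=
  (ContDiffAt.fderiv (m := ω) (n := ω) (f := fun w w' => chartAt E (1 : G) ((g w)⁻¹ * g w'))
    (g := id) (contDiffAt_chart_inv_mul hg) contDiffAt_id le_top).analyticAt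

theorem maurerCartan_eq_complexMaurerCartan {g : W → G} {w : W}
    (hg : ContMDiffAt 𝓘(ℂ, W) 𝓘(ℂ, E) ω g w) (u : W) :
    maurerCartan W E g w u = complexMaurerCartan (E := E) g w u := by
  have : LieGroup 𝓘(ℝ, E) ω G := lieGroup_real
  have hd : DifferentiableAt ℂ (fun w' => chartAt E (1 : G) ((g w)⁻¹ * g w')) w := by
    have h := (contDiffAt_chart_inv_mul hg).differentiableAt (by simp)
    exact h.comp (f := fun w' => (w, w')) w (by fun_prop)
  have hm : MDifferentiableAt 𝓘(ℝ, W) 𝓘(ℝ, E) (fun w' => (g w)⁻¹ * g w') w :=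
    (contMDiffAt_const.mul (contMDiffAt_real hg)).mdifferentiableAt (n := ω) (by simp)
  have h1 : (g w)⁻¹ * g w = 1 := inv_mul_cancel _
  have h2 : maurerCartan W E g w
      = fderiv ℝ (fun w' => chartAt E ((g w)⁻¹ * g w) ((g w)⁻¹ * g w')) w := by
    have h := hm.hasMFDerivAt.2
    simp only [modelWithCornersSelf_coe, Set.range_id] at h
    have h' : HasFDerivAt (fun w' => chartAt E ((g w)⁻¹ * g w) ((g w)⁻¹ * g w'))
        (maurerCartan W E g w) w := hasFDerivWithinAt_univ.1 h
    exact h'.fderiv.symm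
  rw [h2, h1, hd.fderiv_restrictScalars ℝ]
  rfl

theorem differential_clm (J : V →L[ℝ] W) (v : V) : differential V W J v = J := by
  unfold differential
  exact (mfderiv_eq_fderiv).trans J.fderiv

/-- If the Maurer-Cartan form of the family on the submanifold is proportional to the loop
parameter, so is that of its holomorphic extension: both sides of the equation are holomorphic
along the coordinate ball, and they agree on the tangent vectors of the submanifold, which span
the tangent spaces over the complex numbers. -/
theorem AdaptedChart.exists_maurerCartan_eq_smul {ι : M → N} {x₀ : M} (A : AdaptedChart V W ι x₀)
    [FiniteDimensional ℝ V] [FiniteDimensional ℂ W] [CompleteSpace E]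
    [IsManifold 𝓘(ℝ, V) ω M]
    (hdim : Module.finrank ℂ W = Module.finrank ℝ V) (hι : ContinuousAt ι x₀)
    {F : M → Circle → G} (hF : ∀ x z, MDifferentiableAt 𝓘(ℝ, V) 𝓘(ℝ, E) (fun y => F y z) x)
    (hMC : ∀ x, ∃ η : V →L[ℝ] E, ∀ z : Circle, maurerCartan V E (fun y => F y z) x = (z : ℂ) • η)
    {r : ℝ} (hr : 0 < r) (hrt : Metric.ball (A.chart (ι x₀)) r ⊆ A.chart.target)
    {f : N → Circle → G} (hf : IsLocalExtension W E ι F (A.ball r) Set.univ f)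
    {y : N} (hy : y ∈ A.ball r) :
    ∃ η : W →L[ℝ] E, ∀ z : Circle, maurerCartan W E (fun y => f y z) y = (z : ℂ) • η := by
  let φ := A.chart
  let CM := chartAt V x₀
  let g : Circle → W → G := fun z w => f (φ.symm w) z
  have hg : ∀ z, ∀ w ∈ Metric.ball (φ (ι x₀)) r, ContMDiffAt 𝓘(ℂ, W) 𝓘(ℂ, E) ω (g z) w := by
    intro z w hw
    exact (hf.holomorphic _ ⟨w, hw, rfl⟩ z trivial).comp w (A.contMDiffAt_symm w (hrt hw))
  let D : Circle → W → W →L[ℂ] E := fun z => complexMaurerCartan (g z)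
  have hD : ∀ z, AnalyticOnNhd ℂ (fun w => D z w - (z : ℂ) • D 1 w)
      (Metric.ball (φ (ι x₀)) r) := fun z w hw =>
    (analyticAt_complexMaurerCartan (hg z w hw)).sub
      ((analyticAt_complexMaurerCartan (hg 1 w hw)).const_smul (c := (z : ℂ)))
  -- on the totally real subspace the equation is the hypothesis on `F`
  have hreal : ∀ z, ∀ᶠ v in 𝓝 (CM x₀), D z (A.linear v) - (z : ℂ) • D 1 (A.linear v) = 0 := by
    intro z
    have hball : ∀ᶠ v in 𝓝 (CM x₀), A.linear v ∈ Metric.ball (φ (ι x₀)) r := by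
      refine A.linear.continuous.continuousAt.eventually ?_
      rw [← A.chart_base]
      exact Metric.ball_mem_nhds _ hr
    filter_upwards [(A.eventually_symm_apply hι).eventually_nhds, hball.eventually_nhds,
      CM.open_target.mem_nhds (mem_chart_target V x₀)] with v hv1 hv2 hv3
    have hφv : MDifferentiableAt 𝓘(ℝ, V) 𝓘(ℝ, V) CM.symm v :=
      mdifferentiableAt_atlas_symm (chart_mem_atlas V x₀) hv3
    obtain ⟨η, hη⟩ := hMC (CM.symm v)
    have key : ∀ (z : Circle) (u : V), D z (A.linear v) (A.linear u)
        = (z : ℂ) • η (differential V V CM.symm v u) := by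
      intro z u
      have heq : (fun v => g z (A.linear v)) =ᶠ[𝓝 v] fun v => F (CM.symm v) z := by
        filter_upwards [hv1, hv2] with v' h1 h2
        have h3 : ι (CM.symm v') ∈ A.ball r := by
          rw [← h1.2]; exact ⟨_, h2, rfl⟩
        change f (φ.symm (A.linear v')) z = F (CM.symm v') z
        rw [h1.2, hf.apply_eq _ h3 z trivial]
      have hgv := hg z _ hv2.self_of_nhds
      have hlin : MDifferentiableAt 𝓘(ℝ, V) 𝓘(ℝ, W) A.linear v :=
        A.linear.differentiableAt.mdifferentiableAt
      have e1 := maurerCartan_comp (E := E)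
        ((contMDiffAt_real hgv).mdifferentiableAt (by simp)) hlin u
      rw [differential_clm, maurerCartan_eq_complexMaurerCartan hgv, maurerCartan_congr heq,
        maurerCartan_comp (f := fun x => F x z) (hF _ z) hφv u, hη z] at e1
      exact e1.symm
    refine clm_eq_zero_of_comp_totallyReal hdim A.totallyReal fun u => ?_
    rw [sub_apply, smul_apply, key, key]
    simp
  have hball : ∀ z, ∀ w ∈ Metric.ball (φ (ι x₀)) r, D z w = (z : ℂ) • D 1 w := by
    intro z w hw
    have h1 : (fun w => D z w - (z : ℂ) • D 1 w) =ᶠ[𝓝 (φ (ι x₀))] 0 := by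
      have hb : ∀ᶠ w in 𝓝 (φ (ι x₀)), w ∈ Metric.ball (φ (ι x₀)) r := Metric.ball_mem_nhds _ hr
      have hd := hb.mono fun w hw => (hD z w hw).differentiableAt
      have hb' : φ (ι x₀) = A.linear (CM x₀) := A.chart_base
      rw [hb'] at hd ⊢
      exact eventually_eq_zero_of_totallyReal hdim A.totallyReal hd (hreal z)
    exact sub_eq_zero.1 ((hD z).eqOn_zero_of_preconnected_of_eventuallyEq_zero
      (convex_ball _ r).isPreconnected (Metric.mem_ball_self hr) h1 hw)
  obtain ⟨w, hw, rfl⟩ := hy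
  have hyw : φ (φ.symm w) = w := φ.right_inv (hrt hw)
  have hys : φ.symm w ∈ φ.source := φ.map_target (hrt hw)
  refine ⟨((D 1 w).restrictScalars ℝ).comp (differential W W φ (φ.symm w)), fun z => ?_⟩
  ext u
  have heq : (fun y => f y z) =ᶠ[𝓝 (φ.symm w)] fun y => g z (φ y) := by
    filter_upwards [φ.open_source.mem_nhds hys] with y hy
    change f y z = f (φ.symm (φ y)) z
    rw [φ.left_inv hy]
  have hgw : ContMDiffAt 𝓘(ℂ, W) 𝓘(ℂ, E) ω (g z) (φ (φ.symm w)) := by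
    rw [hyw]; exact hg z w hw
  rw [maurerCartan_congr heq, maurerCartan_comp (f := g z)
    ((contMDiffAt_real hgw).mdifferentiableAt (by simp))
    ((contMDiffAt_real (A.contMDiffAt _ hys)).mdifferentiableAt (by simp)),
    maurerCartan_eq_complexMaurerCartan hgw, hyw]
  change D z w _ = _
  rw [hball z w hw]
  rfl

end MaurerCartan

/-! ### Topology of neighbourhoods of a submanifold -/

/-- A connected, locally compact, paracompact Hausdorff space is `σ`-compact: starting from a point
and repeatedly adding the members of a locally finite cover by relatively compact open sets that
meet what has been reached, one exhausts a nonempty clopen set. -/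
theorem sigmaCompactSpace_of_paracompact_connected (X : Type*) [TopologicalSpace X] [T2Space X]
    [ParacompactSpace X] [LocallyCompactSpace X] [ConnectedSpace X] : SigmaCompactSpace X := by
  choose K hK hKx using fun x : X => exists_compact_mem_nhds x
  obtain ⟨v, hvo, hvc, hvf, hvK⟩ := precise_refinement (fun x => interior (K x))
    (fun x => isOpen_interior)
    (Set.eq_univ_of_forall fun x => Set.mem_iUnion.2 ⟨x, mem_interior_iff_mem_nhds.2 (hKx x)⟩)
  have hcl : ∀ i, IsCompact (closure (v i)) := fun i =>
    (hK i).of_isClosed_subset isClosed_closure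
      (closure_minimal ((hvK i).trans interior_subset) (hK i).isClosed)
  have hcov : ∀ x, ∃ i, x ∈ v i := fun x => Set.mem_iUnion.1 (hvc ▸ Set.mem_univ x)
  obtain ⟨x₀⟩ : Nonempty X := inferInstance
  let next : Set X → Set X := fun C => ⋃ i ∈ {i | (v i ∩ C).Nonempty}, closure (v i)
  have hnext : ∀ C i, (v i ∩ C).Nonempty → v i ⊆ next C := fun C i h =>
    subset_closure.trans (Set.subset_biUnion_of_mem (u := fun i => closure (v i)) h)
  let C : ℕ → Set X := fun n => next^[n] {x₀}
  have hCs : ∀ n, C (n + 1) = next (C n) := fun n => Function.iterate_succ_apply' next n _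
  have hC : ∀ n, IsCompact (C n) := by
    intro n
    induction n with
    | zero => exact isCompact_singleton
    | succ n ih =>
      rw [hCs]
      exact (hvf.finite_nonempty_inter_compact ih).isCompact_biUnion fun i _ => hcl i
  have hstep : ∀ n i, (v i ∩ C n).Nonempty → v i ⊆ ⋃ n, C n := fun n i h =>
    (hnext _ i h).trans ((hCs n) ▸ Set.subset_iUnion C (n + 1))
  have hopen : IsOpen (⋃ n, C n) := by
    refine isOpen_iff_mem_nhds.2 fun x hx => ?_
    obtain ⟨n, hn⟩ := Set.mem_iUnion.1 hx
    obtain ⟨i, hi⟩ := hcov x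
    exact Filter.mem_of_superset ((hvo i).mem_nhds hi) (hstep n i ⟨x, hi, hn⟩)
  have hclosed : IsClosed (⋃ n, C n) := by
    refine isClosed_of_closure_subset fun x hx => ?_
    obtain ⟨i, hi⟩ := hcov x
    obtain ⟨y, hyi, hy⟩ := mem_closure_iff.1 hx (v i) (hvo i) hi
    obtain ⟨n, hn⟩ := Set.mem_iUnion.1 hy
    exact hstep n i ⟨y, hyi, hn⟩ hi
  have huniv : ⋃ n, C n = Set.univ :=
    IsClopen.eq_univ ⟨hclosed, hopen⟩ ⟨x₀, Set.mem_iUnion.2 ⟨0, rfl⟩⟩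
  exact ⟨⟨C, hC, huniv⟩⟩

/-- In a metrizable space, neighbourhoods `U x` of points `c x` contain neighbourhoods `B x` such
that whenever `B x` and `B y` meet, one of them lies in the large neighbourhood of the other's
point: take balls of a quarter of the radius. -/
theorem exists_shrinking_of_metrizable {M X : Type*} [TopologicalSpace X]
    [TopologicalSpace.MetrizableSpace X] (c : M → X) (U : M → Set X) (hU : ∀ x, U x ∈ 𝓝 (c x)) :
    ∃ B : M → Set X, (∀ x, IsOpen (B x) ∧ c x ∈ B x) ∧
      ∀ x y, (B x ∩ B y).Nonempty → B x ⊆ U y ∨ B y ⊆ U x := by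
  let := TopologicalSpace.metrizableSpaceMetric X
  choose r hr hrU using fun x => Metric.mem_nhds_iff.1 (hU x)
  have key : ∀ x y, (Metric.ball (c x) (r x / 4) ∩ Metric.ball (c y) (r y / 4)).Nonempty →
      r x ≤ r y → Metric.ball (c x) (r x / 4) ⊆ U y := by
    rintro x y ⟨w, hwx, hwy⟩ hxy u hu
    refine hrU y ?_
    rw [Metric.mem_ball] at *
    have h1 := dist_triangle u (c x) (c y)
    have h2 := dist_triangle_left (c x) (c y) w
    linarith [hr y]
  refine ⟨fun x => Metric.ball (c x) (r x / 4), fun x =>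
    ⟨Metric.isOpen_ball, Metric.mem_ball_self (by linarith [hr x])⟩, fun x y h => ?_⟩
  rcases le_total (r x) (r y) with hxy | hxy
  · exact Or.inl (key x y h hxy)
  · exact Or.inr (key y x (by rwa [Set.inter_comm]) hxy)

/-- The image of a `σ`-compact space in a Hausdorff manifold has a metrizable open neighbourhood,
covered by countably many charts. The shrinking of neighbourhoods can be carried out there. -/
theorem exists_shrinking {M : Type*} [TopologicalSpace M] [SigmaCompactSpace M]
    {H : Type*} [TopologicalSpace H] [SecondCountableTopology H] [LocallyCompactSpace H]
    {N : Type*} [TopologicalSpace N] [T2Space N] [ChartedSpace H N] {ι : M → N}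
    (hι : Continuous ι) (U : M → Set N) (hU : ∀ x, U x ∈ 𝓝 (ι x)) :
    ∃ B : M → Set N, (∀ x, IsOpen (B x) ∧ ι x ∈ B x) ∧
      ∀ x y, (B x ∩ B y).Nonempty → B x ⊆ U y ∨ B y ⊆ U x := by
  obtain ⟨s, hs, hsc⟩ := countable_cover_nhds_of_sigmaCompact
    (f := fun x : M => ι ⁻¹' (chartAt H (ι x)).source)
    (fun x => hι.continuousAt (chart_source_mem_nhds H (ι x)))
  let N' : TopologicalSpace.Opens N :=
    ⟨⋃ x ∈ s, (chartAt H (ι x)).source, isOpen_biUnion fun x _ => (chartAt H (ι x)).open_source⟩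
  have hmem : ∀ x, ι x ∈ N' := fun x => by
    have : x ∈ ⋃ x ∈ s, ι ⁻¹' (chartAt H (ι x)).source := hsc ▸ Set.mem_univ x
    obtain ⟨y, hy, hxy⟩ := Set.mem_iUnion₂.1 this
    exact Set.mem_biUnion (t := fun x => (chartAt H (ι x)).source) hy hxy
  let c : M → N' := fun x => ⟨ι x, hmem x⟩
  have : SecondCountableTopology N' := by
    refine ChartedSpace.secondCountable_of_countable_cover H (s := c '' s) ?_ (hs.image c)
    refine Set.eq_univ_of_forall fun y => ?_
    obtain ⟨x, hx, hxy⟩ := Set.mem_iUnion₂.1 y.2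
    refine Set.mem_biUnion (Set.mem_image_of_mem c hx) ?_
    simpa [TopologicalSpace.Opens.chartAt_eq] using hxy
  have : LocallyCompactSpace N' := ChartedSpace.locallyCompactSpace H N'
  obtain ⟨B, hB, hBU⟩ := exists_shrinking_of_metrizable c (fun x => Subtype.val ⁻¹' U x)
    (fun x => continuous_subtype_val.continuousAt (hU x))
  refine ⟨fun x => Subtype.val '' B x, fun x =>
    ⟨N'.isOpen.isOpenMap_subtype_val _ (hB x).1, ⟨c x, (hB x).2, rfl⟩⟩, ?_⟩
  rintro x y ⟨_, ⟨w, hwx, rfl⟩, ⟨w', hwy, hw⟩⟩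
  obtain rfl : w' = w := Subtype.ext hw
  exact (hBU x y ⟨w', hwx, hwy⟩).imp Set.image_subset_iff.2 Set.image_subset_iff.2

/-! ### Gluing the local extensions -/

section Gluing

theorem mdifferentiableAt_subtype_iff {W : Type*} [NormedAddCommGroup W] [NormedSpace ℂ W]
    {E : Type*} [NormedAddCommGroup E] [NormedSpace ℂ E]
    {N : Type*} [TopologicalSpace N] [ChartedSpace W N]
    {G : Type*} [TopologicalSpace G] [ChartedSpace E G]
    {U : TopologicalSpace.Opens N} {f : N → G} {x : U} :
    MDifferentiableAt 𝓘(ℂ, W) 𝓘(ℂ, E) (fun y : U => f y) x ↔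
      MDifferentiableAt 𝓘(ℂ, W) 𝓘(ℂ, E) f x := by
  exact (differentiableWithinAt_localInvariantProp.liftPropAt_iff_comp_subtype_val f x).symm

variable {V : Type*} [NormedAddCommGroup V] [NormedSpace ℝ V]
  {M : Type*} [TopologicalSpace M] [ChartedSpace V M]
  {W : Type*} [NormedAddCommGroup W] [NormedSpace ℂ W]
  {N : Type*} [TopologicalSpace N] [ChartedSpace W N]
  {E : Type*} [NormedAddCommGroup E] [NormedSpace ℂ E]
  {G : Type*} [TopologicalSpace G] [ChartedSpace E G]

theorem mem_connectionOrderMaps_one_one {X : Type*} [TopologicalSpace X] [ChartedSpace V X]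
    [Group G] {H : Subgroup (Circle → G)} {p : X} {F : X → Circle → G} :
    F ∈ connectionOrderMaps V E H p 1 1 ↔ (∀ x, F x ∈ H) ∧ IsLoopMapOfClass V E ∞ F ∧ F p = 1 ∧
      ∀ x, ∃ η : V →L[ℝ] E, ∀ z : Circle, maurerCartan V E (fun y => F y z) x = (z : ℂ) • η := by
  simp only [connectionOrderMaps, Set.mem_ofPred_eq, Finset.Icc_self, Finset.sum_singleton, zpow_one]
  refine and_congr_right fun _ => and_congr_right fun _ => and_congr_right fun _ =>
    forall_congr' fun x => ⟨fun ⟨A, hA⟩ => ⟨A 1, hA⟩, fun ⟨η, hη⟩ => ⟨fun _ => η, hη⟩⟩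

theorem IsAnalyticLoopMap.contMDiff_apply {X : Type*} [TopologicalSpace X] [ChartedSpace V X]
    {F : X → Circle → G} (hF : IsAnalyticLoopMap V E F) (z : Circle) :
    ContMDiff 𝓘(ℝ, V) 𝓘(ℝ, E) ω (fun x => F x z) :=
  ContMDiff.comp (I' := 𝓘(ℝ, V).prod (𝓡 1)) (f := fun x => (x, z)) hF
    (contMDiff_id.prodMk contMDiff_const)

/-- Near every point of the submanifold the family extends over a coordinate ball, and the
extensions are compatible on all overlaps of these balls, although the overlaps need not meet the
submanifold: the radii are chosen so that of two overlapping balls one is contained in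
the domain of a larger extension about the centre of the other. -/
theorem exists_global_extension [FiniteDimensional ℝ V] [FiniteDimensional ℂ W]
    [FiniteDimensional ℂ E] [T2Space M] [ParacompactSpace M] [ConnectedSpace M] [T2Space N]
    [IsManifold 𝓘(ℂ, W) ω N] [T2Space G] [IsManifold 𝓘(ℂ, E) ω G]
    (hdim : Module.finrank ℂ W = Module.finrank ℝ V) {ι : M → N} (hι : IsInducing ι)
    (A : ∀ x, AdaptedChart V W ι x) {F : M → Circle → G} (hF : IsAnalyticLoopMap V E F) :
    ∃ (r : M → ℝ) (f : N → Circle → G), (∀ x, 0 < r x) ∧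
      (∀ x, Metric.ball ((A x).chart (ι x)) (r x) ⊆ (A x).chart.target) ∧
      ∀ x, IsLocalExtension W E ι F ((A x).ball (r x)) Set.univ f := by
  have : CompleteSpace E := FiniteDimensional.complete ℂ E
  have : FiniteDimensional ℝ W := FiniteDimensional.complexToReal W
  have : ProperSpace W := FiniteDimensional.proper_real W
  have : ProperSpace V := FiniteDimensional.proper_real V
  have : LocallyCompactSpace M := ChartedSpace.locallyCompactSpace V M
  have : SigmaCompactSpace M := sigmaCompactSpace_of_paracompact_connected M
  choose U f hUo hxU hf using fun x => (A x).exists_localExtension hdim hι hF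
  obtain ⟨B, hB, hBU⟩ := exists_shrinking (H := W) hι.continuous U
    (fun x => (hUo x).mem_nhds (hxU x))
  choose r hr hrt hrB using fun x => (A x).exists_ball_subset ((hB x).1.mem_nhds (hB x).2)
  have hBself : ∀ x, B x ⊆ U x := fun x => (hBU x x ⟨_, (hB x).2, (hB x).2⟩).elim id id
  have hcompat : ∀ x x' y, y ∈ (A x).ball (r x) → B x ⊆ U x' → f x y = f x' y := by
    intro x x' y hy hsub
    ext z
    exact (A x).localExtension_unique hdim hι.continuous.continuousAt ((A x).isOpen_ball (hrt x))
      ((A x).isPreconnected_ball (hrt x)) ((A x).mem_ball (hr x))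
      ((hf x).mono ((hrB x).trans (hBself x)) subset_rfl)
      ((hf x').mono ((hrB x).trans hsub) subset_rfl) hy (Set.mem_univ z) (Set.mem_univ z)
  obtain ⟨x₁⟩ : Nonempty M := inferInstance
  have hk : ∀ y : N, ∃ x : M, (∃ x, y ∈ (A x).ball (r x)) → y ∈ (A x).ball (r x) := fun y => by
    by_cases h : ∃ x, y ∈ (A x).ball (r x)
    · exact h.imp fun x hx _ => hx
    · exact ⟨x₁, fun h' => absurd h' h⟩
  choose k hk using hk
  have hglue : ∀ x, ∀ y ∈ (A x).ball (r x), f (k y) y = f x y := by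
    intro x y hy
    have hky := hk y ⟨x, hy⟩
    rcases hBU (k y) x ⟨y, hrB _ hky, hrB _ hy⟩ with h | h
    · exact hcompat _ _ _ hky h
    · exact (hcompat _ _ _ hy h).symm
  refine ⟨r, fun y => f (k y) y, hr, hrt, fun x => ?_⟩
  have hloc := (hf x).mono ((hrB x).trans (hBself x)) subset_rfl
  refine ⟨fun y hy z hz => ?_, fun y hy z hz => ?_, fun x' hx' z hz => ?_⟩
  · refine (hloc.analytic y hy z hz).congr_of_eventuallyEq ?_
    filter_upwards [prod_mem_nhds (((A x).isOpen_ball (hrt x)).mem_nhds hy) Filter.univ_mem]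
      with q hq
    exact congrFun (hglue x q.1 hq.1) q.2
  · refine (hloc.holomorphic y hy z hz).congr_of_eventuallyEq ?_
    filter_upwards [((A x).isOpen_ball (hrt x)).mem_nhds hy] with y' hy'
    exact congrFun (hglue x y' hy') z
  · exact (congrFun (hglue x _ hx') z).trans (hloc.apply_eq x' hx' z hz)

end Gluing

end CurvedFlat

end

open CurvedFlat in
theorem proposition6p2
    -- the complex Lie group `G`, with model space `E`
    {E : Type*} [NormedAddCommGroup E] [NormedSpace ℂ E] [FiniteDimensional ℂ E]
    {G : Type*} [TopologicalSpace G] [T2Space G] [ChartedSpace E G] [Group G]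
    [LieGroup 𝓘(ℂ, E) ω G]
    -- the commuting involution and reality condition of `G`
    (σ₀ ρ₀ : G →* G) (hσ : IsInvolution E σ₀) (hρ : IsRealityCondition E ρ₀)
    (hσρ : ∀ g, σ₀ (ρ₀ g) = ρ₀ (σ₀ g))
    -- the real analytic manifold `M`, with model space `V`
    {V : Type*} [NormedAddCommGroup V] [NormedSpace ℝ V] [FiniteDimensional ℝ V]
    {M : Type*} [TopologicalSpace M] [T2Space M] [ParacompactSpace M] [ConnectedSpace M]
    [ChartedSpace V M] [IsManifold 𝓘(ℝ, V) ω M]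
    -- the complex manifold `N` with model space `W`, of complex dimension the dimension of `M`
    {W : Type*} [NormedAddCommGroup W] [NormedSpace ℂ W] [FiniteDimensional ℂ W]
    {N : Type*} [TopologicalSpace N] [T2Space N]
    [ChartedSpace W N] [IsManifold 𝓘(ℂ, W) ω N]
    (hdim : Module.finrank ℂ W = Module.finrank ℝ V)
    -- `M` is a totally real submanifold of `N`
    (ι : M → N) (hι : IsTotallyRealEmbedding V W ι)
    -- the base point and the extended curved flat
    (p : M) (F : M → Circle → G)
    (hF : F ∈ connectionOrderMaps V E (realTwistedLoopGroup E σ₀ ρ₀) p 1 1)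
    (hFan : IsAnalyticLoopMap V E F) :
    ∃ (Me : TopologicalSpace.Opens N) (hMe : ∀ x, ι x ∈ Me),
      ∃! Fhat : Me → Circle → G,
        Fhat ∈ connectionOrderMaps W E (twistedLoopGroup E σ₀) ⟨ι p, hMe p⟩ 1 1 ∧
        IsHolomorphicLoopMap W E Fhat ∧
        ∀ x, Fhat ⟨ι x, hMe x⟩ = F x := by
  have : CompleteSpace E := FiniteDimensional.complete ℂ E
  have hιc : ∀ x, ContinuousAt ι x := fun x => hι.isEmbedding.continuous.continuousAt
  have A : ∀ x, AdaptedChart V W ι x := fun x =>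
    (nonempty_adaptedChart hdim (hι.analytic x) (hι.totallyReal x)).some
  obtain ⟨hFmem, -, hFp, hFMC⟩ := mem_connectionOrderMaps_one_one.1 hF
  obtain ⟨r, f, hr, hrt, hf⟩ :=
    exists_global_extension hdim hι.isEmbedding.isInducing A hFan
  have hopen : ∀ x, IsOpen ((A x).ball (r x)) := fun x => (A x).isOpen_ball (hrt x)
  have hpre : ∀ x, IsPreconnected ((A x).ball (r x)) := fun x => (A x).isPreconnected_ball (hrt x)
  let Me : TopologicalSpace.Opens N := ⟨⋃ x, (A x).ball (r x), isOpen_iUnion hopen⟩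
  have hsub : ∀ x, (A x).ball (r x) ⊆ Me := fun x =>
    Set.subset_iUnion (fun x => (A x).ball (r x)) x
  have hcov : ∀ y : Me, ∃ x, (y : N) ∈ (A x).ball (r x) := fun y => Set.mem_iUnion.1 y.2
  have hMe : ∀ x, ι x ∈ Me := fun x => hsub x ((A x).mem_ball (hr x))
  have hfι : ∀ x, f (ι x) = F x := fun x => by
    ext z
    exact (hf x).apply_eq x ((A x).mem_ball (hr x)) z trivial
  have hval : ContMDiff 𝓘(ℝ, W) 𝓘(ℝ, W) ω (Subtype.val : Me → N) := contMDiff_subtype_val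
  have han : IsAnalyticLoopMap W E (fun y : Me => f y) := by
    rintro ⟨y, z⟩
    obtain ⟨x, hx⟩ := hcov y
    exact ((hf x).analytic y hx z trivial).comp
      (f := fun q : Me × Circle => ((q.1 : N), q.2)) (y, z)
      ((hval.comp contMDiff_fst).prodMk contMDiff_snd).contMDiffAt
  have htwist : ∀ y : Me, ∀ z, σ₀ (f y (-z)) = f y z := by
    intro y z
    obtain ⟨x, hx⟩ := hcov y
    have hhol : ∀ y ∈ (A x).ball (r x),
        ContMDiffAt 𝓘(ℂ, W) 𝓘(ℂ, E) ω (fun y => σ₀ (f y (-z))) y := fun y hy =>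
      hσ.1.contMDiffAt.comp y ((hf x).holomorphic y hy (-z) trivial)
    have hhol' : ∀ y ∈ (A x).ball (r x), ContMDiffAt 𝓘(ℂ, W) 𝓘(ℂ, E) ω (fun y => f y z) y :=
      fun y hy => (hf x).holomorphic y hy z trivial
    refine (A x).eqOn_of_comp hdim (hιc x) (hopen x) (hpre x) ((A x).mem_ball (hr x))
      (fun y hy => (hhol y hy).mdifferentiableAt (by simp))
      (fun y hy => (hhol' y hy).mdifferentiableAt (by simp))
      (fun y hy => contMDiffAt_real (hhol y hy)) (fun y hy => contMDiffAt_real (hhol' y hy))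
      (fun x' _ => ?_) hx
    simp only [hfι]
    exact congrFun (hFmem x').1.2 z
  refine ⟨Me, hMe, fun y => f y, ⟨?_, ⟨han, fun z y => ?_⟩, hfι⟩, ?_⟩
  · refine mem_connectionOrderMaps_one_one.2 ⟨fun y => ⟨?_, ?_⟩, han.of_le le_top, ?_, fun y => ?_⟩
    · exact han.comp (f := fun z : Circle => (y, z)) (contMDiff_const.prodMk contMDiff_id)
    · exact funext (htwist y)
    · exact (hfι p).trans hFp
    · obtain ⟨x, hx⟩ := hcov y
      obtain ⟨η, hη⟩ := (A x).exists_maurerCartan_eq_smul hdim (hιc x)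
        (fun x z => ((hFan.contMDiff_apply z) x).mdifferentiableAt (by simp)) hFMC (hr x) (hrt x)
        (hf x) hx
      refine ⟨η.comp (differential W W (Subtype.val : Me → N) y), fun z => ?_⟩
      ext u
      rw [maurerCartan_comp (f := fun y => f y z)
        ((contMDiffAt_real ((hf x).holomorphic y hx z trivial)).mdifferentiableAt (by simp))
        (hval.contMDiffAt.mdifferentiableAt (by simp)), hη z]
      rfl
  · obtain ⟨x, hx⟩ := hcov y
    exact mdifferentiableAt_subtype_iff.2
      (((hf x).holomorphic y hx z trivial).mdifferentiableAt (by simp))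
  · rintro H ⟨-, ⟨hHan, hHhol⟩, hHι⟩
    ext y z
    obtain ⟨x, hx⟩ := hcov y
    -- `H` is extended by a constant outside `Me`, so that it can be compared with `f` on `N`
    classical
    let h : N → G := fun y => if hy : y ∈ Me then H ⟨y, hy⟩ z else 1
    have hh : ∀ y : Me, h y = H y z := fun y => dif_pos y.2
    have hh' : (fun y : Me => h y) = fun y => H y z := funext hh
    rw [← hh]
    refine (A x).eqOn_of_comp hdim (hιc x) (hopen x) (hpre x) ((A x).mem_ball (hr x))
      (f := h) (g := fun y => f y z) (fun y hy => ?_)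
      (fun y hy => ((hf x).holomorphic y hy z trivial).mdifferentiableAt (by simp))
      (fun y hy => ?_) (fun y hy => contMDiffAt_real ((hf x).holomorphic y hy z trivial))
      (fun x' hx' => ?_) hx
    · refine (mdifferentiableAt_subtype_iff (x := (⟨y, hsub x hy⟩ : Me))).1 ?_
      rw [hh']
      exact hHhol z _
    · refine (contMDiffAt_subtype_iff (x := (⟨y, hsub x hy⟩ : Me))).1 ?_
      rw [hh']
      exact hHan.contMDiff_apply z _
    · rw [hfι, ← hHι]
      exact hh ⟨ι x', hMe x'⟩
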